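/- Let $(M^n,g)$, $n\ge 3$, be a smooth Riemannian manifold (not assumed complete), let $\rho,\lambda\in\mathbb{R}$, and let $f:M\to\mathbb{R}$ be a non-constant smooth function such that $$Ric+\nabla^2 f=(\rho R+\lambda)\,g ,$$ where $Ric$ and $R$ are the Ricci and scalar curvatures of $g$; that is, $(M^n,g,f,\lambda)$ is a nontrivial gradient $\rho$-Einstein soliton. If $\rho=0$, assume in addition that $dR\wedge df=0$ on $M$. Let $R_{ijkl}$ be the Riemann tensor, with the sign for which $R_{ik}=g^{jl}R_{ijkl}$ is the Ricci tensor (positive on round spheres), let $$W_{ijkl}=R_{ijkl}-\tfrac{1}{n-2}\left(g_{ik}R_{jl}-g_{il}R_{jk}-g_{jk}R_{il}+g_{jl}R_{ik}\right)+\tfrac{R}{(n-1)(n-2)}\left(g_{ik}g_{jl}-g_{il}g_{jk}\right)$$ be the Weyl tensor and $$C_{ijk}=\nabla_iR_{jk}-\nabla_jR_{ik}-\tfrac{1}{2(n-1)}\left(g_{jk}\nabla_iR-g_{ik}\nabla_jR\right)$$ the Cotton tensor. The Bach tensor $B$ is defined by $$B_{ij}=\tfrac{1}{n-3}\nabla^k\nabla^lW_{ikjl}+\tfrac{1}{n-2}R_{kl}W_{i\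 j}^{\ k\ l}\quad\text{if } n\ge 4,\qquad B_{ij}=\nabla^kC_{kij}\quad\text{if } n=3 .$$ If $B(\nabla f,\nabla f)\ge 0$ on $M$, then $B$ vanishes identically: $B(X,Y)=0$ for all vector fields $X,Y$ on $M$. -/

import Mathlib

open scoped Manifold ContDiff

/-! Tensor calculus in a coordinate domain of `ℝⁿ`. A covariant tensor field is given by its
components, functions of the indices and of the point; `G x` is the matrix `(g_ij(x))` of the
metric, and every sum is the sum over a repeated index. -/

noncomputable section

namespace Coord

variable {n : ℕ}

/-- The partial derivative `∂ᵢ u`. -/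
def pd (i : Fin n) (u : EuclideanSpace ℝ (Fin n) → ℝ) (x : EuclideanSpace ℝ (Fin n)) : ℝ :=
  fderiv ℝ u x (EuclideanSpace.single i 1)

/-- The components `g^{ij}` of the inverse metric. -/
def gInv (G : EuclideanSpace ℝ (Fin n) → Matrix (Fin n) (Fin n) ℝ) (i j : Fin n)
    (x : EuclideanSpace ℝ (Fin n)) : ℝ :=
  (G x)⁻¹ i j

/-- The Christoffel symbols `Γ^k_{ij}` of the Levi-Civita connection. -/
def Gam (G : EuclideanSpace ℝ (Fin n) → Matrix (Fin n) (Fin n) ℝ) (k i j : Fin n)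
    (x : EuclideanSpace ℝ (Fin n)) : ℝ :=
  (1 / 2) * ∑ l, gInv G k l x *
    (pd i (fun y => G y j l) x + pd j (fun y => G y i l) x - pd l (fun y => G y i j) x)

/-- The covariant derivative `∇ᵢ Tⱼ` of a covector field. -/
def cov1 (G : EuclideanSpace ℝ (Fin n) → Matrix (Fin n) (Fin n) ℝ)
    (T : Fin n → EuclideanSpace ℝ (Fin n) → ℝ) (i j : Fin n)
    (x : EuclideanSpace ℝ (Fin n)) : ℝ :=
  pd i (T j) x - ∑ s, Gam G s i j x * T s x

/-- The covariant derivative `∇ᵢ T_{jk}` of a covariant 2-tensor field. -/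
def cov2 (G : EuclideanSpace ℝ (Fin n) → Matrix (Fin n) (Fin n) ℝ)
    (T : Fin n → Fin n → EuclideanSpace ℝ (Fin n) → ℝ) (i j k : Fin n)
    (x : EuclideanSpace ℝ (Fin n)) : ℝ :=
  pd i (T j k) x - ∑ s, Gam G s i j x * T s k x - ∑ s, Gam G s i k x * T j s x

/-- The covariant derivative `∇ᵢ T_{jkl}` of a covariant 3-tensor field. -/
def cov3 (G : EuclideanSpace ℝ (Fin n) → Matrix (Fin n) (Fin n) ℝ)
    (T : Fin n → Fin n → Fin n → EuclideanSpace ℝ (Fin n) → ℝ) (i j k l : Fin n)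
    (x : EuclideanSpace ℝ (Fin n)) : ℝ :=
  pd i (T j k l) x - ∑ s, Gam G s i j x * T s k l x - ∑ s, Gam G s i k x * T j s l x
    - ∑ s, Gam G s i l x * T j k s x

/-- The covariant derivative `∇ᵢ T_{jklm}` of a covariant 4-tensor field. -/
def cov4 (G : EuclideanSpace ℝ (Fin n) → Matrix (Fin n) (Fin n) ℝ)
    (T : Fin n → Fin n → Fin n → Fin n → EuclideanSpace ℝ (Fin n) → ℝ) (i j k l m : Fin n)
    (x : EuclideanSpace ℝ (Fin n)) : ℝ :=
  pd i (T j k l m) x - ∑ s, Gam G s i j x * T s k l m x - ∑ s, Gam G s i k x * T j s l m x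
    - ∑ s, Gam G s i l x * T j k s m x - ∑ s, Gam G s i m x * T j k l s x

/-- The Hessian `∇ᵢ∇ⱼ u`. -/
def hess (G : EuclideanSpace ℝ (Fin n) → Matrix (Fin n) (Fin n) ℝ)
    (u : EuclideanSpace ℝ (Fin n) → ℝ) (i j : Fin n) (x : EuclideanSpace ℝ (Fin n)) : ℝ :=
  cov1 G (fun k => pd k u) i j x

/-- The components `∇^i u = g^{ij} ∂ⱼ u` of the gradient. -/
def grad (G : EuclideanSpace ℝ (Fin n) → Matrix (Fin n) (Fin n) ℝ)
    (u : EuclideanSpace ℝ (Fin n) → ℝ) (i : Fin n) (x : EuclideanSpace ℝ (Fin n)) : ℝ :=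
  ∑ j, gInv G i j x * pd j u x

/-- The curvature components `R_{ijk}^r`, where
`∇ⱼ∇ᵢ∂ₖ - ∇ᵢ∇ⱼ∂ₖ = R_{ijk}^r ∂ᵣ`. -/
def Rm13 (G : EuclideanSpace ℝ (Fin n) → Matrix (Fin n) (Fin n) ℝ) (i j k r : Fin n)
    (x : EuclideanSpace ℝ (Fin n)) : ℝ :=
  pd j (Gam G r i k) x - pd i (Gam G r j k) x
    + ∑ s, (Gam G s i k x * Gam G r j s x - Gam G s j k x * Gam G r i s x)

/-- The Riemann tensor `R_{ijkl} = g_{lr} R_{ijk}^r`. -/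
def Rm (G : EuclideanSpace ℝ (Fin n) → Matrix (Fin n) (Fin n) ℝ) (i j k l : Fin n)
    (x : EuclideanSpace ℝ (Fin n)) : ℝ :=
  ∑ r, G x l r * Rm13 G i j k r x

/-- The Ricci tensor `R_{ik} = g^{jl} R_{ijkl}`. -/
def Ric (G : EuclideanSpace ℝ (Fin n) → Matrix (Fin n) (Fin n) ℝ) (i k : Fin n)
    (x : EuclideanSpace ℝ (Fin n)) : ℝ :=
  ∑ j, ∑ l, gInv G j l x * Rm G i j k l x

/-- The scalar curvature `R = g^{ik} R_{ik}`. -/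
def Scal (G : EuclideanSpace ℝ (Fin n) → Matrix (Fin n) (Fin n) ℝ)
    (x : EuclideanSpace ℝ (Fin n)) : ℝ :=
  ∑ i, ∑ k, gInv G i k x * Ric G i k x

/-- The Weyl tensor `W_{ijkl}`. -/
def Weyl (G : EuclideanSpace ℝ (Fin n) → Matrix (Fin n) (Fin n) ℝ) (i j k l : Fin n)
    (x : EuclideanSpace ℝ (Fin n)) : ℝ :=
  Rm G i j k l x
    - 1 / ((n : ℝ) - 2) * (G x i k * Ric G j l x - G x i l * Ric G j k x
        - G x j k * Ric G i l x + G x j l * Ric G i k x)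
    + Scal G x / (((n : ℝ) - 1) * ((n : ℝ) - 2)) * (G x i k * G x j l - G x i l * G x j k)

/-- The Cotton tensor `C_{ijk}`. -/
def Cotton (G : EuclideanSpace ℝ (Fin n) → Matrix (Fin n) (Fin n) ℝ) (i j k : Fin n)
    (x : EuclideanSpace ℝ (Fin n)) : ℝ :=
  cov2 G (Ric G) i j k x - cov2 G (Ric G) j i k x
    - 1 / (2 * ((n : ℝ) - 1)) * (G x j k * pd i (Scal G) x - G x i k * pd j (Scal G) x)

/-- The divergence `∇^l W_{ijkl}` of the Weyl tensor. -/
def divWeyl (G : EuclideanSpace ℝ (Fin n) → Matrix (Fin n) (Fin n) ℝ) (i j k : Fin n)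
    (x : EuclideanSpace ℝ (Fin n)) : ℝ :=
  ∑ l, ∑ m, gInv G l m x * cov4 G (Weyl G) m i j k l x

/-- The Bach tensor: `B_{ij} = ∇^k C_{kij}` in dimension three, and
`B_{ij} = (n-3)⁻¹ ∇^k ∇^l W_{ikjl} + (n-2)⁻¹ R_{kl} W_i^k_j^l` in dimension `n ≥ 4`. -/
def Bach (G : EuclideanSpace ℝ (Fin n) → Matrix (Fin n) (Fin n) ℝ) (i j : Fin n)
    (x : EuclideanSpace ℝ (Fin n)) : ℝ :=
  if n = 3 then
    ∑ k, ∑ m, gInv G k m x * cov3 G (Cotton G) m k i j x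
  else
    1 / ((n : ℝ) - 3) * (∑ k, ∑ m, gInv G k m x * cov3 G (divWeyl G) m i k j x)
      + 1 / ((n : ℝ) - 2) *
        ∑ k, ∑ l, ∑ a, ∑ b, Ric G k l x * gInv G k a x * gInv G l b x * Weyl G i a j b x

end Coord

/-! Riemannian manifolds. A tensor field on `M` is described by its components in the smooth
coordinate charts `φ` of `M`, that is, the members of the maximal atlas; the components are
functions on `φ.target ⊆ ℝⁿ`. -/

section Manifold

variable {n : ℕ} {M : Type*} [TopologicalSpace M] [ChartedSpace (EuclideanSpace ℝ (Fin n)) M]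
  [IsManifold (𝓡 n) ∞ M]

/-- The coordinate vector `∂ᵢ` of the chart `φ` at the point with coordinates `x`. -/
def coordVec (φ : OpenPartialHomeomorph M (EuclideanSpace ℝ (Fin n))) (i : Fin n)
    (x : EuclideanSpace ℝ (Fin n)) : TangentSpace (𝓡 n) (φ.symm x) :=
  mfderiv (𝓡 n) (𝓡 n) φ.symm x
    (EuclideanSpace.single i (1 : ℝ) : EuclideanSpace ℝ (Fin n))

/-- The components `g_{ij} = g(∂ᵢ, ∂ⱼ)` of a Riemannian metric in the chart `φ`. -/
def metricIn
    (g : Bundle.ContMDiffRiemannianMetric (𝓡 n) ∞ (EuclideanSpace ℝ (Fin n))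
      (fun p : M => TangentSpace (𝓡 n) p))
    (φ : OpenPartialHomeomorph M (EuclideanSpace ℝ (Fin n)))
    (x : EuclideanSpace ℝ (Fin n)) : Matrix (Fin n) (Fin n) ℝ :=
  Matrix.of fun i j => g.inner (φ.symm x) (coordVec φ i x) (coordVec φ j x)

/-- `(M, g, f, lam)` is a gradient `ρ`-Einstein soliton: `f` is smooth and
`Ric + ∇²f = (ρ R + lam) g`. -/
structure IsGradientRhoEinsteinSoliton
    (g : Bundle.ContMDiffRiemannianMetric (𝓡 n) ∞ (EuclideanSpace ℝ (Fin n))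
      (fun p : M => TangentSpace (𝓡 n) p))
    (f : M → ℝ) (ρ lam : ℝ) : Prop where
  smooth : ContMDiff (𝓡 n) 𝓘(ℝ, ℝ) ∞ f
  equation : ∀ φ ∈ IsManifold.maximalAtlas (𝓡 n) ∞ M, ∀ x ∈ φ.target, ∀ i j : Fin n,
    Coord.Ric (metricIn g φ) i j x + Coord.hess (metricIn g φ) (f ∘ φ.symm) i j x
      = (ρ * Coord.Scal (metricIn g φ) x + lam) * metricIn g φ x i j

/-- `dR ∧ df = 0` on `M`, where `R` is the scalar curvature of `g`. -/
def WedgeScalZero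
    (g : Bundle.ContMDiffRiemannianMetric (𝓡 n) ∞ (EuclideanSpace ℝ (Fin n))
      (fun p : M => TangentSpace (𝓡 n) p))
    (f : M → ℝ) : Prop :=
  ∀ φ ∈ IsManifold.maximalAtlas (𝓡 n) ∞ M, ∀ x ∈ φ.target, ∀ i j : Fin n,
    Coord.pd i (Coord.Scal (metricIn g φ)) x * Coord.pd j (f ∘ φ.symm) x
      - Coord.pd j (Coord.Scal (metricIn g φ)) x * Coord.pd i (f ∘ φ.symm) x = 0

/-- The Bach tensor is radially nonnegative: `B(∇f, ∇f) ≥ 0` on `M`. -/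
def BachRadiallyNonneg
    (g : Bundle.ContMDiffRiemannianMetric (𝓡 n) ∞ (EuclideanSpace ℝ (Fin n))
      (fun p : M => TangentSpace (𝓡 n) p))
    (f : M → ℝ) : Prop :=
  ∀ φ ∈ IsManifold.maximalAtlas (𝓡 n) ∞ M, ∀ x ∈ φ.target,
    0 ≤ ∑ i, ∑ j, Coord.Bach (metricIn g φ) i j x
      * Coord.grad (metricIn g φ) (f ∘ φ.symm) i x * Coord.grad (metricIn g φ) (f ∘ φ.symm) j x

/-- The Bach tensor vanishes identically on `M`. -/
def BachFlat
    (g : Bundle.ContMDiffRiemannianMetric (𝓡 n) ∞ (EuclideanSpace ℝ (Fin n))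
      (fun p : M => TangentSpace (𝓡 n) p)) : Prop :=
  ∀ φ ∈ IsManifold.maximalAtlas (𝓡 n) ∞ M, ∀ x ∈ φ.target, ∀ i j : Fin n,
    Coord.Bach (metricIn g φ) i j x = 0

end Manifold

end

/-!
The statement is local: it suffices to show that the Bach tensor vanishes in every chart, and there
it is a statement about a metric `G` and a function `u` on an open subset `U` of `ℝⁿ`.

Commuting derivatives in the soliton equation (`IsMetricOn.cov2_cov1_sub`) and contracting gives
`Ric(∇f) = (½ - (n-1)ρ) dR` (`IsSolitonOn.ricGrad_eq`), so that the Cotton tensor is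
`C_{ijk} = -R_{ijkl} ∇^l f - (n-1)⁻¹ (P_i g_{jk} - P_j g_{ik})` with `P = Ric(∇f)`, a formula in
which `ρ` and `λ` no longer occur (`IsSolitonOn.Cotton_eq`). If `ρ ≠ 0`, the form
`(ρR + λ) df - P` is half the differential of `|∇f|²`, and its closedness says `dR ∧ df = 0`
(`IsSolitonOn.pd_Scal_wedge`). Hence `∇f` is an eigenvector of the Ricci tensor wherever it does not
vanish, and `C(·, ·, ∇f) = 0`.

By the Bianchi identities `B_{ij} = (n-2)⁻¹ (∇^k C_{kij} + R^{kl} W_{ikjl})` in all dimensions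
`n ≥ 3`; for `n = 3` this uses that the Weyl tensor vanishes. Differentiating `C(·, ·, ∇f) = 0` turns
`∇^k C_{kij} ∇^i f ∇^j f` into the algebraic expression `R^{kj} C_{kij} ∇^i f`. The curvature terms
cancel, and `B(∇f, ∇f) = -|∇f|² |T|² / (n-2)²`, where `T = Ric - αg - β df ⊗ df` is the part of the
Ricci tensor that is trace-free and orthogonal to `∇f` (`IsSolitonOn.sum_Bach_mul_grad`,
`IsSolitonOn.sum_ricUp_mul_ricDefect`). The sign hypothesis therefore forces `T = 0` wherever
`df ≠ 0`, pointwise and without any integration.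

On that open set `Ric = αg + β df ⊗ df` has a Cotton tensor of a special shape, which vanishes
because it is trace-free and annihilated by `∇f` (`IsSolitonOn.eq_zero_of_trace_of_radial`); then
`W(∇f, ·, ∇f, ·) = 0` and `B = 0`. On the interior of the set where `df = 0` the metric is Einstein
and again `B = 0`. The two open sets together are dense and `B` is continuous, so `B = 0`.
-/

noncomputable section

namespace Coord

variable {n : ℕ} {U : Set (EuclideanSpace ℝ (Fin n))} {x : EuclideanSpace ℝ (Fin n)}
  {u v : EuclideanSpace ℝ (Fin n) → ℝ}
  {G : EuclideanSpace ℝ (Fin n) → Matrix (Fin n) (Fin n) ℝ}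

/-! ### Partial derivatives -/

lemma pd_add (i : Fin n) (hu : DifferentiableAt ℝ u x) (hv : DifferentiableAt ℝ v x) :
    pd i (fun y => u y + v y) x = pd i u x + pd i v x := by
  simp only [pd]; rw [fderiv_fun_add hu hv]; rfl

lemma pd_sub (i : Fin n) (hu : DifferentiableAt ℝ u x) (hv : DifferentiableAt ℝ v x) :
    pd i (fun y => u y - v y) x = pd i u x - pd i v x := by
  simp only [pd]; rw [fderiv_fun_sub hu hv]; rfl

lemma pd_mul (i : Fin n) (hu : DifferentiableAt ℝ u x) (hv : DifferentiableAt ℝ v x) :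
    pd i (fun y => u y * v y) x = pd i u x * v x + u x * pd i v x := by
  simp only [pd]; rw [fderiv_fun_mul hu hv]; simp; ring

@[simp] lemma pd_const (i : Fin n) (c : ℝ) : pd i (fun _ => c) x = 0 := by
  simp [pd]

lemma pd_const_mul (i : Fin n) (c : ℝ) (hu : DifferentiableAt ℝ u x) :
    pd i (fun y => c * u y) x = c * pd i u x := by
  rw [pd_mul i (differentiableAt_const c) hu]; simp

lemma pd_sum {ι : Type*} (s : Finset ι) (i : Fin n) (w : ι → EuclideanSpace ℝ (Fin n) → ℝ)
    (hw : ∀ a ∈ s, DifferentiableAt ℝ (w a) x) :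
    pd i (fun y => ∑ a ∈ s, w a y) x = ∑ a ∈ s, pd i (w a) x := by
  simp only [pd]; rw [fderiv_fun_sum hw]; simp

lemma pd_congr (i : Fin n) (hU : IsOpen U) (hx : x ∈ U) (h : ∀ y ∈ U, u y = v y) :
    pd i u x = pd i v x := by
  have : u =ᶠ[nhds x] v := Filter.eventually_of_mem (hU.mem_nhds hx) h
  simp only [pd]; rw [this.fderiv_eq]

lemma contDiffOn_pd (hU : IsOpen U) (hu : ContDiffOn ℝ ∞ u U) (i : Fin n) :
    ContDiffOn ℝ ∞ (pd i u) U := by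
  have := hu.fderiv_of_isOpen (m := ∞) hU (by simp)
  exact this.clm_apply contDiffOn_const

lemma diffAt (hU : IsOpen U) (hu : ContDiffOn ℝ ∞ u U) (hx : x ∈ U) : DifferentiableAt ℝ u x :=
  (hu.contDiffAt (hU.mem_nhds hx)).differentiableAt (by simp)

lemma pd_comm (hU : IsOpen U) (hu : ContDiffOn ℝ ∞ u U) (hx : x ∈ U) (i j : Fin n) :
    pd i (pd j u) x = pd j (pd i u) x := by
  have hc := hu.contDiffAt (hU.mem_nhds hx)
  have hs : IsSymmSndFDerivAt ℝ u x := hc.isSymmSndFDerivAt (by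
    simp only [minSmoothness_of_isRCLikeNormedField]; exact WithTop.coe_le_coe.2 le_top)
  have hd : DifferentiableAt ℝ (fderiv ℝ u) x :=
    (hc.fderiv_right (m := 1) (by norm_cast)).differentiableAt (by simp)
  have key : ∀ a b : Fin n, pd a (pd b u) x =
      fderiv ℝ (fderiv ℝ u) x (EuclideanSpace.single a 1) (EuclideanSpace.single b 1) := by
    intro a b
    have : pd b u = fun y => fderiv ℝ u y (EuclideanSpace.single b 1) := rfl
    rw [this, pd, fderiv_clm_apply hd (differentiableAt_const _)]
    simp
  rw [key, key]; exact hs _ _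

/-! ### Smoothness of the metric and of the curvature tensors -/

/-- `G` is the matrix of a smooth Riemannian metric on the open set `U`. -/
structure IsMetricOn (G : EuclideanSpace ℝ (Fin n) → Matrix (Fin n) (Fin n) ℝ)
    (U : Set (EuclideanSpace ℝ (Fin n))) : Prop where
  isOpen : IsOpen U
  smooth : ∀ i j, ContDiffOn ℝ ∞ (fun x => G x i j) U
  posDef : ∀ x ∈ U, (G x).PosDef

namespace IsMetricOn

lemma mono {V : Set (EuclideanSpace ℝ (Fin n))} (hG : IsMetricOn G U) (hV : IsOpen V)
    (hVU : V ⊆ U) : IsMetricOn G V :=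
  ⟨hV, fun i j => (hG.smooth i j).mono hVU, fun x hx => hG.posDef x (hVU hx)⟩

lemma symm (hG : IsMetricOn G U) (hx : x ∈ U) (i j : Fin n) : G x i j = G x j i := by
  have := (hG.posDef x hx).isHermitian.apply i j
  simpa using this.symm

lemma isUnit_det (hG : IsMetricOn G U) (hx : x ∈ U) : IsUnit (G x).det :=
  (hG.posDef x hx).det_pos.ne'.isUnit

lemma gInv_symm (hG : IsMetricOn G U) (hx : x ∈ U) (i j : Fin n) :
    gInv G i j x = gInv G j i x := by
  have := (hG.posDef x hx).inv.isHermitian.apply i j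
  simpa [gInv] using this.symm

lemma sum_gInv_mul (hG : IsMetricOn G U) (hx : x ∈ U) (i j : Fin n) :
    ∑ k, gInv G i k x * G x k j = if i = j then 1 else 0 := by
  have := congrFun (congrFun (Matrix.nonsing_inv_mul (G x) (hG.isUnit_det hx)) i) j
  simpa [Matrix.mul_apply, Matrix.one_apply, gInv] using this

lemma contDiffOn_det {m : ℕ} {A : EuclideanSpace ℝ (Fin n) → Matrix (Fin m) (Fin m) ℝ}
    (hA : ∀ i j, ContDiffOn ℝ ∞ (fun x => A x i j) U) :
    ContDiffOn ℝ ∞ (fun x => (A x).det) U := by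
  simp only [Matrix.det_apply]
  refine ContDiffOn.sum fun σ _ => ?_
  refine ContDiffOn.const_smul _ ?_
  exact contDiffOn_prod fun i _ => hA _ _

lemma contDiffOn_gInv (hG : IsMetricOn G U) (i j : Fin n) :
    ContDiffOn ℝ ∞ (gInv G i j) U := by
  have h : ∀ x ∈ U, gInv G i j x = ((G x).det)⁻¹ * ((G x).updateRow j (Pi.single i 1)).det := by
    intro x hx
    simp [gInv, Matrix.inv_def, Matrix.adjugate_apply]
  refine ContDiffOn.congr ?_ h
  refine ((contDiffOn_det hG.smooth).inv fun x hx => (hG.posDef x hx).det_pos.ne').mul ?_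
  refine contDiffOn_det fun a b => ?_
  by_cases hab : a = j
  · subst hab; simp only [Matrix.updateRow_self]; exact contDiffOn_const
  · simp only [Matrix.updateRow_ne hab]; exact hG.smooth a b

lemma contDiffOn_Gam (hG : IsMetricOn G U) (k i j : Fin n) : ContDiffOn ℝ ∞ (Gam G k i j) U := by
  refine contDiffOn_const.mul (ContDiffOn.sum fun l _ => (hG.contDiffOn_gInv k l).mul ?_)
  exact ((contDiffOn_pd hG.isOpen (hG.smooth _ _) _).add
    (contDiffOn_pd hG.isOpen (hG.smooth _ _) _)).sub (contDiffOn_pd hG.isOpen (hG.smooth _ _) _)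

lemma contDiffOn_cov1 (hG : IsMetricOn G U) {T : Fin n → EuclideanSpace ℝ (Fin n) → ℝ}
    (hT : ∀ j, ContDiffOn ℝ ∞ (T j) U) (i j : Fin n) : ContDiffOn ℝ ∞ (cov1 G T i j) U :=
  (contDiffOn_pd hG.isOpen (hT _) _).sub
    (ContDiffOn.sum fun s _ => (hG.contDiffOn_Gam s i j).mul (hT s))

lemma contDiffOn_cov2 (hG : IsMetricOn G U) {T : Fin n → Fin n → EuclideanSpace ℝ (Fin n) → ℝ}
    (hT : ∀ j k, ContDiffOn ℝ ∞ (T j k) U) (i j k : Fin n) :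
    ContDiffOn ℝ ∞ (cov2 G T i j k) U :=
  ((contDiffOn_pd hG.isOpen (hT _ _) _).sub
    (ContDiffOn.sum fun s _ => (hG.contDiffOn_Gam s i j).mul (hT _ _))).sub
    (ContDiffOn.sum fun s _ => (hG.contDiffOn_Gam s i k).mul (hT _ _))

lemma contDiffOn_cov3 (hG : IsMetricOn G U)
    {T : Fin n → Fin n → Fin n → EuclideanSpace ℝ (Fin n) → ℝ}
    (hT : ∀ j k l, ContDiffOn ℝ ∞ (T j k l) U) (i j k l : Fin n) :
    ContDiffOn ℝ ∞ (cov3 G T i j k l) U :=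
  (((contDiffOn_pd hG.isOpen (hT _ _ _) _).sub
    (ContDiffOn.sum fun s _ => (hG.contDiffOn_Gam s i j).mul (hT _ _ _))).sub
    (ContDiffOn.sum fun s _ => (hG.contDiffOn_Gam s i k).mul (hT _ _ _))).sub
    (ContDiffOn.sum fun s _ => (hG.contDiffOn_Gam s i l).mul (hT _ _ _))

lemma contDiffOn_cov4 (hG : IsMetricOn G U)
    {T : Fin n → Fin n → Fin n → Fin n → EuclideanSpace ℝ (Fin n) → ℝ}
    (hT : ∀ j k l m, ContDiffOn ℝ ∞ (T j k l m) U) (i j k l m : Fin n) :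
    ContDiffOn ℝ ∞ (cov4 G T i j k l m) U :=
  ((((contDiffOn_pd hG.isOpen (hT _ _ _ _) _).sub
    (ContDiffOn.sum fun s _ => (hG.contDiffOn_Gam s i j).mul (hT _ _ _ _))).sub
    (ContDiffOn.sum fun s _ => (hG.contDiffOn_Gam s i k).mul (hT _ _ _ _))).sub
    (ContDiffOn.sum fun s _ => (hG.contDiffOn_Gam s i l).mul (hT _ _ _ _))).sub
    (ContDiffOn.sum fun s _ => (hG.contDiffOn_Gam s i m).mul (hT _ _ _ _))

lemma contDiffOn_grad (hG : IsMetricOn G U) (hu : ContDiffOn ℝ ∞ u U) (i : Fin n) :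
    ContDiffOn ℝ ∞ (grad G u i) U :=
  ContDiffOn.sum fun j _ => (hG.contDiffOn_gInv i j).mul (contDiffOn_pd hG.isOpen hu j)

lemma contDiffOn_Rm13 (hG : IsMetricOn G U) (i j k r : Fin n) :
    ContDiffOn ℝ ∞ (Rm13 G i j k r) U :=
  ((contDiffOn_pd hG.isOpen (hG.contDiffOn_Gam _ _ _) _).sub
    (contDiffOn_pd hG.isOpen (hG.contDiffOn_Gam _ _ _) _)).add
    (ContDiffOn.sum fun _ _ => ((hG.contDiffOn_Gam _ _ _).mul (hG.contDiffOn_Gam _ _ _)).sub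
      ((hG.contDiffOn_Gam _ _ _).mul (hG.contDiffOn_Gam _ _ _)))

lemma contDiffOn_Rm (hG : IsMetricOn G U) (i j k l : Fin n) :
    ContDiffOn ℝ ∞ (Rm G i j k l) U :=
  ContDiffOn.sum fun r _ => (hG.smooth l r).mul (hG.contDiffOn_Rm13 i j k r)

lemma contDiffOn_Ric (hG : IsMetricOn G U) (i k : Fin n) : ContDiffOn ℝ ∞ (Ric G i k) U :=
  ContDiffOn.sum fun j _ => ContDiffOn.sum fun l _ =>
    (hG.contDiffOn_gInv j l).mul (hG.contDiffOn_Rm i j k l)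

lemma contDiffOn_Scal (hG : IsMetricOn G U) : ContDiffOn ℝ ∞ (Scal G) U :=
  ContDiffOn.sum fun j _ => ContDiffOn.sum fun l _ =>
    (hG.contDiffOn_gInv j l).mul (hG.contDiffOn_Ric j l)

lemma contDiffOn_Weyl (hG : IsMetricOn G U) (i j k l : Fin n) :
    ContDiffOn ℝ ∞ (Weyl G i j k l) U :=
  ((hG.contDiffOn_Rm i j k l).sub (contDiffOn_const.mul
    (((((hG.smooth _ _).mul (hG.contDiffOn_Ric _ _)).sub
      ((hG.smooth _ _).mul (hG.contDiffOn_Ric _ _))).sub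
      ((hG.smooth _ _).mul (hG.contDiffOn_Ric _ _))).add
      ((hG.smooth _ _).mul (hG.contDiffOn_Ric _ _))))).add
    ((hG.contDiffOn_Scal.div_const _).mul
      (((hG.smooth _ _).mul (hG.smooth _ _)).sub ((hG.smooth _ _).mul (hG.smooth _ _))))

lemma contDiffOn_Cotton (hG : IsMetricOn G U) (i j k : Fin n) :
    ContDiffOn ℝ ∞ (Cotton G i j k) U :=
  ((hG.contDiffOn_cov2 hG.contDiffOn_Ric _ _ _).sub
    (hG.contDiffOn_cov2 hG.contDiffOn_Ric _ _ _)).sub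
    (contDiffOn_const.mul
      (((hG.smooth _ _).mul (contDiffOn_pd hG.isOpen hG.contDiffOn_Scal _)).sub
      ((hG.smooth _ _).mul (contDiffOn_pd hG.isOpen hG.contDiffOn_Scal _))))

lemma contDiffOn_divWeyl (hG : IsMetricOn G U) (i j k : Fin n) :
    ContDiffOn ℝ ∞ (divWeyl G i j k) U :=
  ContDiffOn.sum fun _ _ => ContDiffOn.sum fun _ _ =>
    (hG.contDiffOn_gInv _ _).mul (hG.contDiffOn_cov4 hG.contDiffOn_Weyl _ _ _ _ _)

lemma continuousOn_Bach (hG : IsMetricOn G U) (i j : Fin n) : ContinuousOn (Bach G i j) U := by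
  by_cases h3 : n = 3
  · have : Bach G i j = fun x => ∑ k, ∑ m, gInv G k m x * cov3 G (Cotton G) m k i j x := by
      funext x; simp [Bach, h3]
    rw [this]
    exact (ContDiffOn.sum fun k _ => ContDiffOn.sum fun m _ =>
      (hG.contDiffOn_gInv _ _).mul (hG.contDiffOn_cov3 hG.contDiffOn_Cotton _ _ _ _)).continuousOn
  · have : Bach G i j = fun x =>
        1 / ((n : ℝ) - 3) * (∑ k, ∑ m, gInv G k m x * cov3 G (divWeyl G) m i k j x)
        + 1 / ((n : ℝ) - 2) *
        ∑ k, ∑ l, ∑ a, ∑ b, Ric G k l x * gInv G k a x * gInv G l b x * Weyl G i a j b x := by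
      funext x; simp [Bach, h3]
    rw [this]
    exact ((contDiffOn_const.mul (ContDiffOn.sum fun k _ => ContDiffOn.sum fun m _ =>
      (hG.contDiffOn_gInv _ _).mul (hG.contDiffOn_cov3 hG.contDiffOn_divWeyl _ _ _ _))).add
      (contDiffOn_const.mul (ContDiffOn.sum fun k _ => ContDiffOn.sum fun l _ =>
        ContDiffOn.sum fun a _ => ContDiffOn.sum fun b _ =>
        (((hG.contDiffOn_Ric _ _).mul (hG.contDiffOn_gInv _ _)).mul (hG.contDiffOn_gInv _ _)).mul
          (hG.contDiffOn_Weyl _ _ _ _)))).continuousOn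

end IsMetricOn

/-! ### Curvature in matrix form: symmetries and Bianchi identities -/

/-- The entrywise partial derivative of a matrix-valued function. -/
def pdM (i : Fin n) (A : EuclideanSpace ℝ (Fin n) → Matrix (Fin n) (Fin n) ℝ)
    (x : EuclideanSpace ℝ (Fin n)) : Matrix (Fin n) (Fin n) ℝ :=
  Matrix.of fun r s => pd i (fun y => A y r s) x

/-- The connection matrix `(A_j)^r_s = Γ^r_{js}`. -/
def conn (G : EuclideanSpace ℝ (Fin n) → Matrix (Fin n) (Fin n) ℝ) (j : Fin n)
    (x : EuclideanSpace ℝ (Fin n)) : Matrix (Fin n) (Fin n) ℝ :=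
  Matrix.of fun r s => Gam G r j s x

/-- The curvature matrix `F_{ij} = ∂ᵢA_j - ∂_jA_i + [A_i, A_j]`. -/
def curv (G : EuclideanSpace ℝ (Fin n) → Matrix (Fin n) (Fin n) ℝ) (i j : Fin n)
    (x : EuclideanSpace ℝ (Fin n)) : Matrix (Fin n) (Fin n) ℝ :=
  pdM i (conn G j) x - pdM j (conn G i) x + (conn G i x * conn G j x - conn G j x * conn G i x)

/-- A matrix-valued function with smooth entries on `U`. -/
def SmoothMat (A : EuclideanSpace ℝ (Fin n) → Matrix (Fin n) (Fin n) ℝ)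
    (U : Set (EuclideanSpace ℝ (Fin n))) : Prop :=
  ∀ r s, ContDiffOn ℝ ∞ (fun y => A y r s) U

section MatrixCalculus

variable {A B : EuclideanSpace ℝ (Fin n) → Matrix (Fin n) (Fin n) ℝ}

lemma SmoothMat.mul (hA : SmoothMat A U) (hB : SmoothMat B U) :
    SmoothMat (fun y => A y * B y) U := fun r s => by
  simp only [Matrix.mul_apply]
  exact ContDiffOn.sum fun t _ => (hA r t).mul (hB t s)

lemma SmoothMat.add (hA : SmoothMat A U) (hB : SmoothMat B U) :
    SmoothMat (fun y => A y + B y) U := fun r s => (hA r s).add (hB r s)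

lemma SmoothMat.sub (hA : SmoothMat A U) (hB : SmoothMat B U) :
    SmoothMat (fun y => A y - B y) U := fun r s => (hA r s).sub (hB r s)

lemma SmoothMat.transpose (hA : SmoothMat A U) : SmoothMat (fun y => (A y).transpose) U :=
  fun r s => hA s r

lemma SmoothMat.pdM (hU : IsOpen U) (hA : SmoothMat A U) (i : Fin n) :
    SmoothMat (pdM i A) U := fun r s => contDiffOn_pd hU (hA r s) i

lemma pdM_add (hU : IsOpen U) (hx : x ∈ U) (hA : SmoothMat A U) (hB : SmoothMat B U) (i : Fin n) :
    pdM i (fun y => A y + B y) x = pdM i A x + pdM i B x := by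
  ext r s
  exact pd_add i (diffAt hU (hA r s) hx) (diffAt hU (hB r s) hx)

lemma pdM_sub (hU : IsOpen U) (hx : x ∈ U) (hA : SmoothMat A U) (hB : SmoothMat B U) (i : Fin n) :
    pdM i (fun y => A y - B y) x = pdM i A x - pdM i B x := by
  ext r s
  exact pd_sub i (diffAt hU (hA r s) hx) (diffAt hU (hB r s) hx)

lemma pdM_mul (hU : IsOpen U) (hx : x ∈ U) (hA : SmoothMat A U) (hB : SmoothMat B U) (i : Fin n) :
    pdM i (fun y => A y * B y) x = pdM i A x * B x + A x * pdM i B x := by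
  ext r s
  have : pdM i (fun y => A y * B y) x r s = pd i (fun y => ∑ t, A y r t * B y t s) x := by
    simp [pdM, Matrix.mul_apply]
  rw [this, pd_sum]
  · simp only [Matrix.add_apply, Matrix.mul_apply, ← Finset.sum_add_distrib]
    exact Finset.sum_congr rfl fun t _ =>
      pd_mul i (diffAt hU (hA r t) hx) (diffAt hU (hB t s) hx)
  · exact fun t _ => (diffAt hU (hA r t) hx).mul (diffAt hU (hB t s) hx)

lemma pdM_transpose (i : Fin n) :
    pdM i (fun y => (A y).transpose) x = (pdM i A x).transpose := rfl

lemma pdM_congr (hU : IsOpen U) (hx : x ∈ U) (h : ∀ y ∈ U, A y = B y) (i : Fin n) :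
    pdM i A x = pdM i B x := by
  ext r s
  exact pd_congr i hU hx fun y hy => by rw [h y hy]

lemma pdM_comm (hU : IsOpen U) (hx : x ∈ U) (hA : SmoothMat A U) (i j : Fin n) :
    pdM i (pdM j A) x = pdM j (pdM i A) x := by
  ext r s
  exact pd_comm hU (hA r s) hx i j

end MatrixCalculus

lemma Rm13_eq_curv (i j k r : Fin n) : Rm13 G i j k r x = curv G j i x r k := by
  simp only [Rm13, curv, pdM, conn, Matrix.add_apply, Matrix.sub_apply, Matrix.mul_apply,
    Matrix.of_apply, Finset.sum_sub_distrib]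
  congr 1; congr 1 <;> exact Finset.sum_congr rfl fun _ _ => mul_comm _ _

lemma Rm_eq_curv (i j k l : Fin n) : Rm G i j k l x = (G x * curv G j i x) l k := by
  simp [Rm, Rm13_eq_curv, Matrix.mul_apply]

lemma curv_antisymm (i j : Fin n) : curv G i j x = - curv G j i x := by
  simp only [curv]; abel

lemma Rm_antisymm_left (i j k l : Fin n) : Rm G i j k l x = - Rm G j i k l x := by
  rw [Rm_eq_curv, Rm_eq_curv, curv_antisymm]; simp

namespace IsMetricOn

lemma Gam_symm (hG : IsMetricOn G U) (hx : x ∈ U) (k i j : Fin n) :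
    Gam G k i j x = Gam G k j i x := by
  simp only [Gam]
  congr 1
  refine Finset.sum_congr rfl fun l _ => ?_
  rw [pd_congr l hG.isOpen hx fun y hy => hG.symm hy i j]
  ring

lemma sum_mul_Gam (hG : IsMetricOn G U) (hx : x ∈ U) (l i j : Fin n) :
    ∑ s, G x l s * Gam G s i j x = 1 / 2 * (pd i (fun y => G y j l) x
      + pd j (fun y => G y i l) x - pd l (fun y => G y i j) x) := by
  set B : Fin n → ℝ := fun l => 1 / 2 * (pd i (fun y => G y j l) x
      + pd j (fun y => G y i l) x - pd l (fun y => G y i j) x) with hB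
  have h1 : ∀ s, Gam G s i j x = ((G x)⁻¹.mulVec B) s := by
    intro s
    simp only [Gam, gInv, Matrix.mulVec, dotProduct, hB, Finset.mul_sum]
    exact Finset.sum_congr rfl fun _ _ => by ring
  have h2 : (G x).mulVec ((G x)⁻¹.mulVec B) = B := by
    rw [Matrix.mulVec_mulVec, Matrix.mul_nonsing_inv _ (hG.isUnit_det hx), Matrix.one_mulVec]
  have := congrFun h2 l
  simp only [h1]
  exact this

/-- The metric is parallel. -/
lemma pd_metric (hG : IsMetricOn G U) (hx : x ∈ U) (m j k : Fin n) :
    pd m (fun y => G y j k) x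
      = ∑ s, Gam G s m j x * G x s k + ∑ s, Gam G s m k x * G x j s := by
  have h1 : ∑ s, Gam G s m j x * G x s k = ∑ s, G x k s * Gam G s m j x :=
    Finset.sum_congr rfl fun s _ => by rw [hG.symm hx s k, mul_comm]
  have h2 : ∑ s, Gam G s m k x * G x j s = ∑ s, G x j s * Gam G s m k x :=
    Finset.sum_congr rfl fun s _ => by rw [mul_comm]
  rw [h1, h2, hG.sum_mul_Gam hx, hG.sum_mul_Gam hx,
    pd_congr m hG.isOpen hx fun y hy => hG.symm hy k j,
    pd_congr j hG.isOpen hx fun y hy => hG.symm hy m k,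
    pd_congr k hG.isOpen hx fun y hy => hG.symm hy m j,
    pd_congr j hG.isOpen hx fun y hy => hG.symm hy k m,
    pd_congr k hG.isOpen hx fun y hy => hG.symm hy j m]
  ring

lemma smoothMat_conn (hG : IsMetricOn G U) (i : Fin n) : SmoothMat (conn G i) U :=
  fun r s => hG.contDiffOn_Gam r i s

lemma smoothMat_curv (hG : IsMetricOn G U) (i j : Fin n) : SmoothMat (curv G i j) U :=
  (((hG.smoothMat_conn j).pdM hG.isOpen i).sub ((hG.smoothMat_conn i).pdM hG.isOpen j)).add
    (((hG.smoothMat_conn i).mul (hG.smoothMat_conn j)).sub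
      ((hG.smoothMat_conn j).mul (hG.smoothMat_conn i)))

lemma pdM_metric (hG : IsMetricOn G U) (hx : x ∈ U) (m : Fin n) :
    pdM m G x = (conn G m x).transpose * G x + G x * conn G m x := by
  ext j k
  simp only [pdM, conn, Matrix.add_apply, Matrix.mul_apply, Matrix.transpose_apply,
    Matrix.of_apply]
  rw [hG.pd_metric hx]
  simp only [mul_comm]

/-- Skew-adjointness of the curvature: differentiate `∂ⱼ g = Aⱼᵀ g + g Aⱼ` once more and use
that second derivatives of `g` commute. -/
lemma metric_mul_curv (hG : IsMetricOn G U) (hx : x ∈ U) (i j : Fin n) :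
    (curv G i j x).transpose * G x + G x * curv G i j x = 0 := by
  have hU := hG.isOpen
  have hs : SmoothMat G U := hG.smooth
  have hA := hG.smoothMat_conn
  have key : ∀ a b, pdM a (pdM b G) x =
      (pdM a (conn G b) x).transpose * G x
      + (conn G b x).transpose * ((conn G a x).transpose * G x + G x * conn G a x)
      + (((conn G a x).transpose * G x + G x * conn G a x) * conn G b x
        + G x * pdM a (conn G b) x) := by
    intro a b
    rw [pdM_congr hU hx (fun y hy => hG.pdM_metric hy b) a,
      pdM_add hU hx ((hA b).transpose.mul hs) (hs.mul (hA b)),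
      pdM_mul hU hx (hA b).transpose hs, pdM_mul hU hx hs (hA b), pdM_transpose,
      hG.pdM_metric hx]
  have h := pdM_comm hU hx hs i j
  rw [key, key, ← sub_eq_zero] at h
  rw [← h]
  simp only [curv, Matrix.transpose_add, Matrix.transpose_sub, Matrix.transpose_mul]
  noncomm_ring

lemma Rm_antisymm_right (hG : IsMetricOn G U) (hx : x ∈ U) (i j k l : Fin n) :
    Rm G i j k l x = - Rm G i j l k x := by
  rw [Rm_eq_curv, Rm_eq_curv]
  have h := congrFun (congrFun (hG.metric_mul_curv hx j i) l) k
  have h2 : ((curv G j i x).transpose * G x) l k = (G x * curv G j i x) k l := by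
    simp only [Matrix.mul_apply, Matrix.transpose_apply]
    exact Finset.sum_congr rfl fun s _ => by rw [hG.symm hx s k, mul_comm]
  rw [Matrix.add_apply, h2] at h
  simp only [Matrix.zero_apply] at h
  linarith

lemma Rm13_bianchi (hG : IsMetricOn G U) (hx : x ∈ U) (i j k r : Fin n) :
    Rm13 G i j k r x + Rm13 G j k i r x + Rm13 G k i j r x = 0 := by
  have h : ∀ a b c : Fin n, pd a (Gam G r b c) x = pd a (Gam G r c b) x := fun a b c =>
    pd_congr a hG.isOpen hx fun y hy => hG.Gam_symm hy r b c
  simp only [Rm13, Finset.sum_sub_distrib]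
  rw [h j i k, h k j i, h i k j]
  simp only [hG.Gam_symm hx _ k i, hG.Gam_symm hx _ j i, hG.Gam_symm hx _ k j]
  ring

lemma Rm_bianchi (hG : IsMetricOn G U) (hx : x ∈ U) (i j k l : Fin n) :
    Rm G i j k l x + Rm G j k i l x + Rm G k i j l x = 0 := by
  simp only [Rm, ← Finset.sum_add_distrib, ← mul_add, hG.Rm13_bianchi hx, mul_zero,
    Finset.sum_const_zero]

lemma Rm_pair_symm (hG : IsMetricOn G U) (hx : x ∈ U) (i j k l : Fin n) :
    Rm G i j k l x = Rm G k l i j x := by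
  have b := hG.Rm_bianchi hx
  have r := hG.Rm_antisymm_right hx
  have s := fun i j k l => Rm_antisymm_left (G := G) (x := x) i j k l
  linarith [b i j k l, b j k l i, b k l i j, b l i j k, r i j k l, r j k i l, r k i j l, r j k l i,
    r k l j i, r l j k i, r k l i j, r l i k j, r i k l j, r l i j k, r i j l k, r j l i k,
    s i j k l, s j k i l, s k i j l, s j k l i, s k l j i, s l j k i, s k l i j, s l i k j,
    s i k l j, s l i j k, s i j l k, s j l i k, s i k j l]

lemma cov4_Rm_eq (hG : IsMetricOn G U) (hx : x ∈ U) (m i j k l : Fin n) :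
    cov4 G (Rm G) m i j k l x =
      (G x * (pdM m (curv G j i) x + conn G m x * curv G j i x - curv G j i x * conn G m x)) l k
      - ∑ s, Gam G s m i x * (G x * curv G j s x) l k
      - ∑ s, Gam G s m j x * (G x * curv G s i x) l k := by
  have h0 : pd m (Rm G i j k l) x = pdM m (fun y => G y * curv G j i y) x l k := by
    simp only [pdM, Matrix.of_apply, ← Rm_eq_curv]
  have h1 : ∑ s, Gam G s m l x * Rm G i j k s x
      = ((conn G m x).transpose * (G x * curv G j i x)) l k := by
    rw [Matrix.mul_apply]
    simp only [Rm_eq_curv, conn, Matrix.transpose_apply, Matrix.of_apply]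
  have h2 : ∑ s, Gam G s m k x * Rm G i j s l x = ((G x * curv G j i x) * conn G m x) l k := by
    rw [Matrix.mul_apply]
    simp only [Rm_eq_curv, conn, Matrix.of_apply, mul_comm]
  have h3 := congrFun (congrFun (pdM_mul hG.isOpen hx (A := G) (B := curv G j i) hG.smooth
    (hG.smoothMat_curv j i) m) l) k
  simp only [cov4]
  rw [h0, h1, h2, h3, hG.pdM_metric hx]
  simp only [Rm_eq_curv, mul_sub, mul_add, add_mul, Matrix.add_apply, Matrix.sub_apply,
    Matrix.mul_assoc]
  ring

/-- The differential Bianchi identity for the curvature matrices; the mixed second derivatives of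
the connection matrices cancel in the cyclic sum. -/
lemma curv_bianchi (hG : IsMetricOn G U) (hx : x ∈ U) (m i j : Fin n) :
    (pdM m (curv G j i) x + conn G m x * curv G j i x - curv G j i x * conn G m x)
    + (pdM i (curv G m j) x + conn G i x * curv G m j x - curv G m j x * conn G i x)
    + (pdM j (curv G i m) x + conn G j x * curv G i m x - curv G i m x * conn G j x) = 0 := by
  have hU := hG.isOpen
  have hA := hG.smoothMat_conn
  have key : ∀ a b c, pdM a (curv G b c) x = pdM a (pdM b (conn G c)) x
      - pdM a (pdM c (conn G b)) x
      + (pdM a (conn G b) x * conn G c x + conn G b x * pdM a (conn G c) x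
        - (pdM a (conn G c) x * conn G b x + conn G c x * pdM a (conn G b) x)) := by
    intro a b c
    have e : curv G b c = fun y => (pdM b (conn G c) y - pdM c (conn G b) y)
      + (conn G b y * conn G c y - conn G c y * conn G b y) := rfl
    rw [e, pdM_add hU hx (((hA c).pdM hU b).sub ((hA b).pdM hU c))
      (((hA b).mul (hA c)).sub ((hA c).mul (hA b))),
      pdM_sub hU hx ((hA c).pdM hU b) ((hA b).pdM hU c),
      pdM_sub hU hx ((hA b).mul (hA c)) ((hA c).mul (hA b)),
      pdM_mul hU hx (hA b) (hA c), pdM_mul hU hx (hA c) (hA b)]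
  rw [key, key, key, pdM_comm hU hx (hA i) m j, pdM_comm hU hx (hA j) m i,
    pdM_comm hU hx (hA m) i j]
  simp only [curv]
  noncomm_ring

lemma cov4_Rm_bianchi (hG : IsMetricOn G U) (hx : x ∈ U) (m i j k l : Fin n) :
    cov4 G (Rm G) m i j k l x + cov4 G (Rm G) i j m k l x + cov4 G (Rm G) j m i k l x = 0 := by
  rw [hG.cov4_Rm_eq hx, hG.cov4_Rm_eq hx, hG.cov4_Rm_eq hx]
  have h : (G x * ((pdM m (curv G j i) x + conn G m x * curv G j i x - curv G j i x * conn G m x)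
    + (pdM i (curv G m j) x + conn G i x * curv G m j x - curv G m j x * conn G i x)
    + (pdM j (curv G i m) x + conn G j x * curv G i m x - curv G i m x * conn G j x))) l k = 0 := by
    rw [hG.curv_bianchi hx m i j, Matrix.mul_zero, Matrix.zero_apply]
  rw [Matrix.mul_add, Matrix.mul_add, Matrix.add_apply, Matrix.add_apply] at h
  simp only [hG.Gam_symm hx _ m i, hG.Gam_symm hx _ j m, hG.Gam_symm hx _ j i]
  have e : ∀ a b c, ∑ s, Gam G s a b x * (G x * curv G c s x) l k
      = - ∑ s, Gam G s a b x * (G x * curv G s c x) l k := by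
    intro a b c
    rw [← Finset.sum_neg_distrib]
    refine Finset.sum_congr rfl fun s _ => ?_
    rw [curv_antisymm c s]; simp
  rw [e, e, e]
  linarith

end IsMetricOn

/-! ### Metric contraction -/

/-- The metric contraction `g^{km} F_{km}` at the point `x`. -/
def ctr (G : EuclideanSpace ℝ (Fin n) → Matrix (Fin n) (Fin n) ℝ) (x : EuclideanSpace ℝ (Fin n))
    (F : Fin n → Fin n → ℝ) : ℝ :=
  ∑ k, ∑ m, gInv G k m x * F k m

lemma ctr_add (F H : Fin n → Fin n → ℝ) :
    ctr G x (fun k m => F k m + H k m) = ctr G x F + ctr G x H := by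
  simp only [ctr, mul_add, Finset.sum_add_distrib]

lemma ctr_sub (F H : Fin n → Fin n → ℝ) :
    ctr G x (fun k m => F k m - H k m) = ctr G x F - ctr G x H := by
  simp only [ctr, mul_sub, Finset.sum_sub_distrib]

lemma ctr_neg (F : Fin n → Fin n → ℝ) :
    ctr G x (fun k m => - F k m) = - ctr G x F := by
  simp only [ctr, mul_neg, Finset.sum_neg_distrib]

lemma ctr_mul_left (c : ℝ) (F : Fin n → Fin n → ℝ) :
    ctr G x (fun k m => c * F k m) = c * ctr G x F := by
  simp only [ctr, Finset.mul_sum]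
  exact Finset.sum_congr rfl fun _ _ => Finset.sum_congr rfl fun _ _ => by ring

lemma ctr_mul_right (c : ℝ) (F : Fin n → Fin n → ℝ) :
    ctr G x (fun k m => F k m * c) = ctr G x F * c := by
  simp only [ctr, Finset.sum_mul]
  exact Finset.sum_congr rfl fun _ _ => Finset.sum_congr rfl fun _ _ => by ring

lemma ctr_sum (F : Fin n → Fin n → Fin n → ℝ) :
    ctr G x (fun k m => ∑ s, F s k m) = ∑ s, ctr G x (F s) := by
  simp only [ctr, Finset.mul_sum]
  exact (Finset.sum_congr rfl fun k _ => Finset.sum_comm).trans Finset.sum_comm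

lemma ctr_congr {F H : Fin n → Fin n → ℝ} (h : ∀ k m, F k m = H k m) :
    ctr G x F = ctr G x H := by
  rw [show F = H from funext fun k => funext (h k)]

lemma ctr_comm (F : Fin n → Fin n → Fin n → Fin n → ℝ) :
    ctr G x (fun i j => ctr G x (fun k m => F i j k m))
      = ctr G x (fun k m => ctr G x (fun i j => F i j k m)) := by
  have h : ∀ F : Fin n → Fin n → ℝ, ctr G x F = ∑ p : Fin n × Fin n, gInv G p.1 p.2 x * F p.1 p.2 :=
    fun F => by rw [ctr, ← Finset.sum_product', Finset.univ_product_univ]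
  simp only [h, Finset.mul_sum]
  rw [Finset.sum_comm]
  exact Finset.sum_congr rfl fun _ _ => Finset.sum_congr rfl fun _ _ => by ring

lemma Ric_eq_ctr (i k : Fin n) : Ric G i k x = ctr G x (fun j l => Rm G i j k l x) := rfl

lemma Scal_eq_ctr : Scal G x = ctr G x (fun i k => Ric G i k x) := rfl

namespace IsMetricOn

lemma ctr_swap (hG : IsMetricOn G U) (hx : x ∈ U) (F : Fin n → Fin n → ℝ) :
    ctr G x (fun k m => F m k) = ctr G x F := by
  simp only [ctr]
  rw [Finset.sum_comm]
  exact Finset.sum_congr rfl fun i _ => Finset.sum_congr rfl fun j _ => by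
    rw [hG.gInv_symm hx]

lemma ctr_mul_metric (hG : IsMetricOn G U) (hx : x ∈ U) (T : Fin n → ℝ) (j : Fin n) :
    ctr G x (fun k m => T k * G x m j) = T j := by
  simp only [ctr]
  have : ∀ k, ∑ m, gInv G k m x * (T k * G x m j) = T k * if k = j then 1 else 0 := by
    intro k
    rw [← hG.sum_gInv_mul hx, Finset.mul_sum]
    exact Finset.sum_congr rfl fun _ _ => by ring
  simp [this]

lemma ctr_mul_metric' (hG : IsMetricOn G U) (hx : x ∈ U) (T : Fin n → ℝ) (j : Fin n) :
    ctr G x (fun k m => T k * G x j m) = T j := by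
  simp only [hG.symm hx j]; exact hG.ctr_mul_metric hx T j

lemma ctr_metric_mul (hG : IsMetricOn G U) (hx : x ∈ U) (T : Fin n → ℝ) (j : Fin n) :
    ctr G x (fun k m => G x k j * T m) = T j := by
  rw [← hG.ctr_mul_metric hx T j, ← hG.ctr_swap hx]
  exact ctr_congr fun _ _ => mul_comm _ _

lemma ctr_metric_mul' (hG : IsMetricOn G U) (hx : x ∈ U) (T : Fin n → ℝ) (j : Fin n) :
    ctr G x (fun k m => G x j k * T m) = T j := by
  simp only [hG.symm hx j]; exact hG.ctr_metric_mul hx T j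

lemma ctr_metric (hG : IsMetricOn G U) (hx : x ∈ U) : ctr G x (fun k m => G x k m) = n := by
  simp only [ctr]
  have : ∀ k, ∑ m, gInv G k m x * G x k m = 1 := by
    intro k
    have := hG.sum_gInv_mul hx k k
    simp only [if_true] at this
    rw [← this]
    exact Finset.sum_congr rfl fun m _ => by rw [hG.symm hx]
  simp [this]

/-- The inverse metric is parallel. -/
lemma pd_gInv (hG : IsMetricOn G U) (hx : x ∈ U) (m i j : Fin n) :
    pd m (gInv G i j) x
      = - ∑ s, Gam G i m s x * gInv G s j x - ∑ s, Gam G j m s x * gInv G i s x := by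
  have hU := hG.isOpen
  have hI : SmoothMat (fun y => (G y)⁻¹) U := hG.contDiffOn_gInv
  have h1 : pdM m (fun y => (G y)⁻¹ * G y) x = 0 := by
    rw [pdM_congr hU hx (B := fun _ => 1)
      (fun y hy => Matrix.nonsing_inv_mul (G y) (hG.isUnit_det hy))]
    ext r s; simp [pdM]
  rw [pdM_mul hU hx hI hG.smooth, hG.pdM_metric hx] at h1
  have hc := Matrix.mul_nonsing_inv (G x) (hG.isUnit_det hx)
  have hc' := Matrix.nonsing_inv_mul (G x) (hG.isUnit_det hx)
  have h2 : pdM m (fun y => (G y)⁻¹) x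
      = - ((G x)⁻¹ * (conn G m x).transpose) - conn G m x * (G x)⁻¹ := by
    have h3 := congrArg (fun B => B * (G x)⁻¹) h1
    simp only [Matrix.add_mul, Matrix.mul_add, Matrix.mul_assoc, hc, Matrix.zero_mul,
      Matrix.mul_one] at h3
    rw [← Matrix.mul_assoc _ (G x), hc', Matrix.one_mul] at h3
    rw [eq_neg_of_add_eq_zero_left h3]; abel
  have h4 := congrFun (congrFun h2 i) j
  simp only [Matrix.sub_apply, Matrix.neg_apply, Matrix.mul_apply, conn, Matrix.transpose_apply,
    Matrix.of_apply] at h4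
  have h5 : pd m (gInv G i j) x = pdM m (fun y => (G y)⁻¹) x i j := rfl
  rw [h5, h4]
  simp only [gInv, mul_comm]
  ring

/-- Contraction commutes with covariant differentiation. -/
lemma pd_ctr (hG : IsMetricOn G U) (hx : x ∈ U) (a : Fin n)
    {T : Fin n → Fin n → EuclideanSpace ℝ (Fin n) → ℝ} (hT : ∀ k m, ContDiffOn ℝ ∞ (T k m) U) :
    pd a (fun y => ctr G y (fun k m => T k m y)) x = ctr G x (fun k m => cov2 G T a k m x) := by
  have hU := hG.isOpen
  have dI := fun k m => diffAt hU (hG.contDiffOn_gInv k m) hx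
  have dT := fun k m => diffAt hU (hT k m) hx
  have h1 : pd a (fun y => ctr G y (fun k m => T k m y)) x
      = ∑ k, ∑ m, (pd a (gInv G k m) x * T k m x + gInv G k m x * pd a (T k m) x) := by
    simp only [ctr]
    rw [pd_sum _ _ (fun k y => ∑ m, gInv G k m y * T k m y)
      fun k _ => DifferentiableAt.fun_sum fun m _ => (dI k m).mul (dT k m)]
    refine Finset.sum_congr rfl fun k _ => ?_
    rw [pd_sum _ _ (fun m y => gInv G k m y * T k m y) fun m _ => (dI k m).mul (dT k m)]
    exact Finset.sum_congr rfl fun m _ => pd_mul _ (dI k m) (dT k m)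
  rw [h1]
  simp only [hG.pd_gInv hx, ctr, cov2, Finset.sum_add_distrib, mul_sub, sub_mul, neg_mul,
    Finset.sum_sub_distrib, Finset.sum_neg_distrib, Finset.mul_sum, Finset.sum_mul]
  have e1 : ∑ k, ∑ m, ∑ s, Gam G k a s x * gInv G s m x * T k m x
      = ∑ k, ∑ m, ∑ s, gInv G k m x * (Gam G s a k x * T s m x) := by
    have : ∀ F : Fin n → Fin n → Fin n → ℝ, ∑ k, ∑ m, ∑ s, F k m s = ∑ s, ∑ m, ∑ k, F k m s := by
      intro F
      rw [Finset.sum_comm]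
      conv_rhs => rw [Finset.sum_comm]
      exact Finset.sum_congr rfl fun m _ => Finset.sum_comm
    rw [this]
    exact Finset.sum_congr rfl fun _ _ => Finset.sum_congr rfl fun _ _ =>
      Finset.sum_congr rfl fun _ _ => by ring
  have e2 : ∑ k, ∑ m, ∑ s, Gam G m a s x * gInv G k s x * T k m x
      = ∑ k, ∑ m, ∑ s, gInv G k m x * (Gam G s a m x * T k s x) := by
    refine Finset.sum_congr rfl fun k _ => ?_
    rw [Finset.sum_comm]
    exact Finset.sum_congr rfl fun _ _ => Finset.sum_congr rfl fun _ _ => by ring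
  rw [e1, e2]; ring

/-! ### Symmetries and contractions of the covariant derivative of curvature -/

lemma Ric_symm (hG : IsMetricOn G U) (hx : x ∈ U) (i k : Fin n) : Ric G i k x = Ric G k i x := by
  rw [Ric_eq_ctr, Ric_eq_ctr, ← hG.ctr_swap hx]
  exact ctr_congr fun j l => hG.Rm_pair_symm hx i l k j

lemma cov4_Rm_antisymm_left (hG : IsMetricOn G U) (hx : x ∈ U) (m i j k l : Fin n) :
    cov4 G (Rm G) m i j k l x = - cov4 G (Rm G) m j i k l x := by
  rw [hG.cov4_Rm_eq hx, hG.cov4_Rm_eq hx, curv_antisymm j i]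
  have h1 : ∀ a b c d : Fin n, ∑ s, Gam G s a b x * (G x * curv G c s x) d k
      = - ∑ s, Gam G s a b x * (G x * curv G s c x) d k := by
    intro a b c d
    rw [← Finset.sum_neg_distrib]
    exact Finset.sum_congr rfl fun s _ => by rw [curv_antisymm c s]; simp
  have h2 : pdM m (curv G j i) x = - pdM m (curv G i j) x := by
    ext r s
    simp only [pdM, Matrix.of_apply, Matrix.neg_apply]
    have : (fun y => curv G j i y r s) = fun y => (-1 : ℝ) * curv G i j y r s := by
      funext y; rw [curv_antisymm j i]; simp
    rw [this, pd_const_mul m _ (diffAt hG.isOpen (hG.smoothMat_curv i j r s) hx)]; ring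
  rw [h1 m i j l, h1 m j i l, h2]
  have h3 : G x * (-pdM m (curv G i j) x + conn G m x * -curv G i j x - -curv G i j x * conn G m x)
    = - (G x * (pdM m (curv G i j) x + conn G m x * curv G i j x
      - curv G i j x * conn G m x)) := by noncomm_ring
  rw [h3, Matrix.neg_apply]; ring

lemma cov4_Rm_antisymm_right (hG : IsMetricOn G U) (hx : x ∈ U) (m i j k l : Fin n) :
    cov4 G (Rm G) m i j k l x = - cov4 G (Rm G) m i j l k x := by
  simp only [cov4]
  have h : pd m (Rm G i j k l) x = - pd m (Rm G i j l k) x := by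
    rw [pd_congr (v := fun y => (-1 : ℝ) * Rm G i j l k y) m hG.isOpen hx fun y hy => by
      rw [hG.Rm_antisymm_right hy]; ring]
    rw [pd_const_mul m _ (diffAt hG.isOpen (hG.contDiffOn_Rm i j l k) hx)]; ring
  rw [h]
  simp only [hG.Rm_antisymm_right hx _ _ k l, hG.Rm_antisymm_right hx _ _ _ l,
    hG.Rm_antisymm_right hx _ _ k _, mul_neg, Finset.sum_neg_distrib]
  ring

lemma ctr_cov4_Rm (hG : IsMetricOn G U) (hx : x ∈ U) (m i k : Fin n) :
    ctr G x (fun j l => cov4 G (Rm G) m i j k l x) = cov2 G (Ric G) m i k x := by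
  have h : pd m (Ric G i k) x = ctr G x (fun j l => cov2 G (fun j l => Rm G i j k l) m j l x) :=
    hG.pd_ctr hx m fun j l => hG.contDiffOn_Rm i j k l
  rw [cov2, h]
  simp only [Ric_eq_ctr, ← ctr_mul_left, ← ctr_sum, ← ctr_sub]
  exact ctr_congr fun j l => by simp only [cov4, cov2]; ring

lemma ctr_cov2_Ric (hG : IsMetricOn G U) (hx : x ∈ U) (m : Fin n) :
    ctr G x (fun i k => cov2 G (Ric G) m i k x) = pd m (Scal G) x :=
  (hG.pd_ctr hx m hG.contDiffOn_Ric).symm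

/-- The contracted differential Bianchi identity `∇^l R_{ijkl} = ∇ⱼ R_{ik} - ∇ᵢ R_{jk}`. -/
lemma div_Rm (hG : IsMetricOn G U) (hx : x ∈ U) (i j k : Fin n) :
    ctr G x (fun l m => cov4 G (Rm G) m i j k l x)
      = cov2 G (Ric G) j i k x - cov2 G (Ric G) i j k x := by
  have h1 : ctr G x (fun l m => cov4 G (Rm G) i j m k l x) = cov2 G (Ric G) i j k x := by
    rw [← hG.ctr_cov4_Rm hx, ← hG.ctr_swap hx]
  have h2 : ctr G x (fun l m => cov4 G (Rm G) j m i k l x) = - cov2 G (Ric G) j i k x := by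
    rw [← hG.ctr_cov4_Rm hx, ← hG.ctr_swap hx, ← ctr_neg]
    exact ctr_congr fun l m => hG.cov4_Rm_antisymm_left hx _ _ _ _ _
  have h3 : ctr G x (fun l m => cov4 G (Rm G) m i j k l x + cov4 G (Rm G) i j m k l x
      + cov4 G (Rm G) j m i k l x) = 0 := by
    rw [ctr_congr fun l m => hG.cov4_Rm_bianchi hx m i j k l]; simp [ctr]
  rw [ctr_add, ctr_add, h1, h2] at h3
  linarith

/-- The twice contracted Bianchi identity `∇^l R_{il} = ½ ∇ᵢ R`. -/
lemma div_Ric (hG : IsMetricOn G U) (hx : x ∈ U) (i : Fin n) :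
    ctr G x (fun l m => cov2 G (Ric G) m i l x) = 1 / 2 * pd i (Scal G) x := by
  have h1 : ctr G x (fun j k => ctr G x (fun l m => cov4 G (Rm G) m i j k l x))
      = - ctr G x (fun l m => cov2 G (Ric G) m i l x) := by
    rw [ctr_comm, ← ctr_neg]
    refine ctr_congr fun l m => ?_
    rw [← hG.ctr_cov4_Rm hx, ← ctr_neg]
    exact ctr_congr fun j k => hG.cov4_Rm_antisymm_right hx _ _ _ _ _
  simp only [hG.div_Rm hx] at h1
  rw [ctr_sub, hG.ctr_cov2_Ric hx, ← hG.ctr_swap hx] at h1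
  linarith

end IsMetricOn

/-! ### The Schouten, Weyl and Cotton tensors -/

lemma sum_mul_const_mul (c : ℝ) (a F : Fin n → ℝ) :
    ∑ s, a s * (c * F s) = c * ∑ s, a s * F s := by
  rw [Finset.mul_sum]; exact Finset.sum_congr rfl fun _ _ => by ring

lemma sum_mul_mul_const (c : ℝ) (a F : Fin n → ℝ) :
    ∑ s, a s * (F s * c) = (∑ s, a s * F s) * c := by
  rw [Finset.sum_mul]; exact Finset.sum_congr rfl fun _ _ => by ring

/-- The Schouten tensor `A = (n-2)⁻¹ (Ric - R / (2(n-1)) g)`. -/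
def schouten (G : EuclideanSpace ℝ (Fin n) → Matrix (Fin n) (Fin n) ℝ) (j l : Fin n)
    (x : EuclideanSpace ℝ (Fin n)) : ℝ :=
  1 / ((n : ℝ) - 2) * (Ric G j l x - 1 / (2 * ((n : ℝ) - 1)) * (Scal G x * G x j l))

lemma natCast_sub_one_ne (hn : 3 ≤ n) : (n : ℝ) - 1 ≠ 0 := by
  have : (3 : ℝ) ≤ n := by exact_mod_cast hn
  linarith

lemma natCast_sub_two_ne (hn : 3 ≤ n) : (n : ℝ) - 2 ≠ 0 := by
  have : (3 : ℝ) ≤ n := by exact_mod_cast hn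
  linarith

lemma Weyl_eq_schouten (hn : 3 ≤ n) (i j k l : Fin n) :
    Weyl G i j k l x = Rm G i j k l x - (G x i k * schouten G j l x - G x i l * schouten G j k x
      - G x j k * schouten G i l x + G x j l * schouten G i k x) := by
  have h1 := natCast_sub_one_ne hn
  have h2 := natCast_sub_two_ne hn
  simp only [Weyl, schouten]
  field_simp
  ring

/-- A trace-free tensor with the symmetries of a curvature tensor vanishes in dimension three.
Write `W_{ijkl} = ε_{ijp} ε_{klq} A_{pq}` with `A` symmetric and `M_{ik} = h_{jl} W_{ijkl}`. Then
`det(h) A = ½ tr(h M) h - h M h`, so `M = 0` gives `A = 0`. -/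
lemma curvatureLike_eq_zero_of_dim_three (h : Fin 3 → Fin 3 → ℝ)
    (W : Fin 3 → Fin 3 → Fin 3 → Fin 3 → ℝ) (hs : ∀ i j, h i j = h j i)
    (hdet : (Matrix.of h).det ≠ 0) (hl : ∀ i j k l, W i j k l = - W j i k l)
    (hr : ∀ i j k l, W i j k l = - W i j l k) (hp : ∀ i j k l, W i j k l = W k l i j)
    (ht : ∀ i k, ∑ j, ∑ l, h j l * W i j k l = 0) (i j k l : Fin 3) : W i j k l = 0 := by
  have z1 : ∀ i k l, W i i k l = 0 := fun i k l => by linarith [hl i i k l]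
  have z2 : ∀ i j k, W i j k k = 0 := fun i j k => by linarith [hr i j k k]
  have e00 := ht 0 0
  have e01 := ht 0 1
  have e02 := ht 0 2
  have e11 := ht 1 1
  have e12 := ht 1 2
  have e22 := ht 2 2
  simp only [Fin.sum_univ_three, z1, z2, mul_zero, add_zero, zero_add,
    hs 1 0, hs 2 0, hs 2 1, hl 1 0, hl 2 0, hl 2 1, hr _ _ 1 0, hr _ _ 2 0, hr _ _ 2 1,
    hp 0 2 0 1, hp 1 2 0 1, hp 1 2 0 2] at e00 e01 e02 e11 e12 e22
  have hd : (Matrix.of h).det = h 0 0 * (h 1 1 * h 2 2 - h 1 2 * h 1 2)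
      - h 0 1 * (h 0 1 * h 2 2 - h 1 2 * h 0 2) + h 0 2 * (h 0 1 * h 1 2 - h 1 1 * h 0 2) := by
    rw [Matrix.det_fin_three]
    simp only [Matrix.of_apply, hs 1 0, hs 2 0, hs 2 1]; ring
  rw [hd] at hdet
  -- `c_{pq}` is the vanishing of `A_{pq}`, with the coefficients read off from the identity above.
  have c22 : W 0 1 0 1 = 0 := by
    refine (mul_eq_zero.1 ?_).resolve_left hdet
    linear_combination (1 / 2 * h 2 2) * (h 0 0 * e00 + h 1 1 * e11 + h 2 2 * e22
      + 2 * h 0 1 * e01 + 2 * h 0 2 * e02 + 2 * h 1 2 * e12)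
      - (h 0 2 * h 0 2 * e00 + h 1 2 * h 1 2 * e11 + h 2 2 * h 2 2 * e22
      + 2 * h 0 2 * h 1 2 * e01 + 2 * h 0 2 * h 2 2 * e02 + 2 * h 1 2 * h 2 2 * e12)
  have c11 : W 0 2 0 2 = 0 := by
    refine (mul_eq_zero.1 ?_).resolve_left hdet
    linear_combination (1 / 2 * h 1 1) * (h 0 0 * e00 + h 1 1 * e11 + h 2 2 * e22
      + 2 * h 0 1 * e01 + 2 * h 0 2 * e02 + 2 * h 1 2 * e12)
      - (h 0 1 * h 0 1 * e00 + h 1 1 * h 1 1 * e11 + h 1 2 * h 1 2 * e22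
      + 2 * h 0 1 * h 1 1 * e01 + 2 * h 0 1 * h 1 2 * e02 + 2 * h 1 1 * h 1 2 * e12)
  have c00 : W 1 2 1 2 = 0 := by
    refine (mul_eq_zero.1 ?_).resolve_left hdet
    linear_combination (1 / 2 * h 0 0) * (h 0 0 * e00 + h 1 1 * e11 + h 2 2 * e22
      + 2 * h 0 1 * e01 + 2 * h 0 2 * e02 + 2 * h 1 2 * e12)
      - (h 0 0 * h 0 0 * e00 + h 0 1 * h 0 1 * e11 + h 0 2 * h 0 2 * e22
      + 2 * h 0 0 * h 0 1 * e01 + 2 * h 0 0 * h 0 2 * e02 + 2 * h 0 1 * h 0 2 * e12)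
  have c12 : W 0 1 0 2 = 0 := by
    refine (mul_eq_zero.1 ?_).resolve_left hdet
    linear_combination (-1 : ℝ) * ((1 / 2 * h 1 2) * (h 0 0 * e00 + h 1 1 * e11 + h 2 2 * e22
      + 2 * h 0 1 * e01 + 2 * h 0 2 * e02 + 2 * h 1 2 * e12)
      - (h 0 1 * h 0 2 * e00 + h 1 1 * h 1 2 * e11 + h 1 2 * h 2 2 * e22
      + (h 0 1 * h 1 2 + h 0 2 * h 1 1) * e01 + (h 0 1 * h 2 2 + h 0 2 * h 1 2) * e02
      + (h 1 1 * h 2 2 + h 1 2 * h 1 2) * e12))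
  have c02 : W 0 1 1 2 = 0 := by
    refine (mul_eq_zero.1 ?_).resolve_left hdet
    linear_combination (1 / 2 * h 0 2) * (h 0 0 * e00 + h 1 1 * e11 + h 2 2 * e22
      + 2 * h 0 1 * e01 + 2 * h 0 2 * e02 + 2 * h 1 2 * e12)
      - (h 0 0 * h 0 2 * e00 + h 0 1 * h 1 2 * e11 + h 0 2 * h 2 2 * e22
      + (h 0 0 * h 1 2 + h 0 2 * h 0 1) * e01 + (h 0 0 * h 2 2 + h 0 2 * h 0 2) * e02
      + (h 0 1 * h 2 2 + h 0 2 * h 1 2) * e12)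
  have c01 : W 0 2 1 2 = 0 := by
    refine (mul_eq_zero.1 ?_).resolve_left hdet
    linear_combination (-1 : ℝ) * ((1 / 2 * h 0 1) * (h 0 0 * e00 + h 1 1 * e11 + h 2 2 * e22
      + 2 * h 0 1 * e01 + 2 * h 0 2 * e02 + 2 * h 1 2 * e12)
      - (h 0 0 * h 0 1 * e00 + h 0 1 * h 1 1 * e11 + h 0 2 * h 1 2 * e22
      + (h 0 0 * h 1 1 + h 0 1 * h 0 1) * e01 + (h 0 0 * h 1 2 + h 0 2 * h 0 1) * e02
      + (h 0 1 * h 1 2 + h 0 2 * h 1 1) * e12))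
  have a1 := hl i j k l
  have a2 := hr i j k l
  have a3 := hr j i k l
  have a4 := hp i j k l
  have a5 := hp i j l k
  have a6 := hp j i k l
  have a7 := hp j i l k
  fin_cases i <;> fin_cases j <;> fin_cases k <;> fin_cases l <;>
    simp only [Fin.zero_eta, Fin.mk_one, Fin.reduceFinMk] at a1 a2 a3 a4 a5 a6 a7 ⊢ <;> linarith

lemma Weyl_antisymm_left (hn : 3 ≤ n) (i j k l : Fin n) :
    Weyl G i j k l x = - Weyl G j i k l x := by
  rw [Weyl_eq_schouten hn, Weyl_eq_schouten hn, Rm_antisymm_left]; ring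

lemma Cotton_antisymm (i j k : Fin n) : Cotton G i j k x = - Cotton G j i k x := by
  simp only [Cotton]; ring

/-- The Ricci tensor with both indices raised. -/
def ricUp (G : EuclideanSpace ℝ (Fin n) → Matrix (Fin n) (Fin n) ℝ) (a b : Fin n)
    (x : EuclideanSpace ℝ (Fin n)) : ℝ :=
  ∑ k, ∑ l, Ric G k l x * gInv G k a x * gInv G l b x

namespace IsMetricOn

lemma schouten_symm (hG : IsMetricOn G U) (hx : x ∈ U) (j l : Fin n) :
    schouten G j l x = schouten G l j x := by
  simp only [schouten, hG.Ric_symm hx j l, hG.symm hx j l]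

lemma contDiffOn_schouten (hG : IsMetricOn G U) (j l : Fin n) :
    ContDiffOn ℝ ∞ (schouten G j l) U :=
  contDiffOn_const.mul ((hG.contDiffOn_Ric j l).sub
    (contDiffOn_const.mul (hG.contDiffOn_Scal.mul (hG.smooth j l))))

lemma cov2_mul_metric (hG : IsMetricOn G U) (hx : x ∈ U) (hu : ContDiffOn ℝ ∞ u U)
    (m j l : Fin n) :
    pd m (fun y => u y * G y j l) x - ∑ s, Gam G s m j x * (u x * G x s l)
      - ∑ s, Gam G s m l x * (u x * G x j s) = pd m u x * G x j l := by
  have hU := hG.isOpen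
  rw [pd_mul m (diffAt hU hu hx) (diffAt hU (hG.smooth j l) hx), hG.pd_metric hx]
  rw [sum_mul_const_mul, sum_mul_const_mul]; ring

lemma cov2_schouten (hG : IsMetricOn G U) (hx : x ∈ U) (m j l : Fin n) :
    cov2 G (schouten G) m j l x = 1 / ((n : ℝ) - 2) * (cov2 G (Ric G) m j l x
      - 1 / (2 * ((n : ℝ) - 1)) * (pd m (Scal G) x * G x j l)) := by
  have hU := hG.isOpen
  have hgs := hG.contDiffOn_Scal.mul (hG.smooth j l)
  rw [← hG.cov2_mul_metric hx hG.contDiffOn_Scal]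
  simp only [cov2]
  have h : pd m (schouten G j l) x = 1 / ((n : ℝ) - 2) * (pd m (Ric G j l) x
      - 1 / (2 * ((n : ℝ) - 1)) * pd m (fun y => Scal G y * G y j l) x) := by
    change pd m (fun y => 1 / ((n : ℝ) - 2) * (Ric G j l y
      - 1 / (2 * ((n : ℝ) - 1)) * (Scal G y * G y j l))) x = _
    rw [← pd_const_mul m _ (diffAt hU hgs hx), ← pd_sub m (diffAt hU (hG.contDiffOn_Ric j l) hx)
      (diffAt hU (contDiffOn_const.mul hgs) hx), ← pd_const_mul]
    exact diffAt hU ((hG.contDiffOn_Ric j l).sub (contDiffOn_const.mul hgs)) hx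
  rw [h]
  have e : ∀ c d : ℝ, ∀ a A B : Fin n → ℝ, ∑ s, a s * (c * (A s - d * B s))
      = c * (∑ s, a s * A s - d * ∑ s, a s * B s) := by
    intro c d a A B
    simp only [Finset.mul_sum, ← Finset.sum_sub_distrib]
    exact Finset.sum_congr rfl fun _ _ => by ring
  simp only [schouten, e]
  ring

lemma cov4_Weyl (hn : 3 ≤ n) (hG : IsMetricOn G U) (hx : x ∈ U) (m i j k l : Fin n) :
    cov4 G (Weyl G) m i j k l x = cov4 G (Rm G) m i j k l x
      - (G x i k * cov2 G (schouten G) m j l x - G x i l * cov2 G (schouten G) m j k x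
      - G x j k * cov2 G (schouten G) m i l x + G x j l * cov2 G (schouten G) m i k x) := by
  have hU := hG.isOpen
  obtain ⟨p, hp⟩ : ∃ p : Fin n → Fin n → Fin n → Fin n → EuclideanSpace ℝ (Fin n) → ℝ,
    p = fun i j k l y => G y i k * schouten G j l y := ⟨_, rfl⟩
  have dgA : ∀ i j k l, DifferentiableAt ℝ (p i j k l) x := fun i j k l => by
    rw [hp]; exact diffAt hU ((hG.smooth i k).mul (hG.contDiffOn_schouten j l)) hx
  have key : ∀ i j k l, pd m (p i j k l) x
      = G x i k * cov2 G (schouten G) m j l x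
        + ∑ s, Gam G s m i x * (G x s k * schouten G j l x)
        + ∑ s, Gam G s m k x * (G x i s * schouten G j l x)
        + ∑ s, Gam G s m j x * (G x i k * schouten G s l x)
        + ∑ s, Gam G s m l x * (G x i k * schouten G j s x) := by
    intro i j k l
    rw [hp, pd_mul m (diffAt hU (hG.smooth i k) hx) (diffAt hU (hG.contDiffOn_schouten j l) hx),
      hG.pd_metric hx]
    rw [sum_mul_const_mul, sum_mul_const_mul, sum_mul_mul_const, sum_mul_mul_const, cov2]; ring
  have h : pd m (Weyl G i j k l) x = pd m (Rm G i j k l) x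
      - (pd m (p i j k l) x - pd m (p i j l k) x - pd m (p j i k l) x + pd m (p j i l k) x) := by
    have hW : ∀ y ∈ U, Weyl G i j k l y
        = Rm G i j k l y - (p i j k l y - p i j l k y - p j i k l y + p j i l k y) :=
      fun y _ => by rw [hp]; exact Weyl_eq_schouten hn i j k l
    rw [pd_congr m hU hx hW,
      pd_sub m (diffAt hU (hG.contDiffOn_Rm i j k l) hx)
        ((((dgA _ _ _ _).fun_sub (dgA _ _ _ _)).fun_sub (dgA _ _ _ _)).fun_add (dgA _ _ _ _)),
      pd_add m (((dgA _ _ _ _).fun_sub (dgA _ _ _ _)).fun_sub (dgA _ _ _ _)) (dgA _ _ _ _),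
      pd_sub m ((dgA _ _ _ _).fun_sub (dgA _ _ _ _)) (dgA _ _ _ _),
      pd_sub m (dgA _ _ _ _) (dgA _ _ _ _)]
  rw [cov4, h, key, key, key, key]
  simp only [Weyl_eq_schouten hn, cov4, mul_sub, mul_add, Finset.sum_sub_distrib,
    Finset.sum_add_distrib]
  ring

lemma div_schouten (hn : 3 ≤ n) (hG : IsMetricOn G U) (hx : x ∈ U) (i : Fin n) :
    ctr G x (fun l m => cov2 G (schouten G) m i l x)
      = 1 / (2 * ((n : ℝ) - 1)) * pd i (Scal G) x := by
  have h1 := natCast_sub_one_ne hn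
  have h2 := natCast_sub_two_ne hn
  simp only [hG.cov2_schouten hx]
  rw [ctr_mul_left, ctr_sub, ctr_mul_left, hG.div_Ric hx,
    ← hG.ctr_swap hx (fun l m => pd m (Scal G) x * G x i l), hG.ctr_mul_metric' hx]
  field_simp
  ring

/-- `∇^l W_{ijkl} = -(n-3)/(n-2) C_{ijk}`. -/
lemma divWeyl_eq_Cotton (hn : 3 ≤ n) (hG : IsMetricOn G U) (hx : x ∈ U) (i j k : Fin n) :
    divWeyl G i j k x = - (((n : ℝ) - 3) / ((n : ℝ) - 2)) * Cotton G i j k x := by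
  have h1 := natCast_sub_one_ne hn
  have h2 := natCast_sub_two_ne hn
  have e : divWeyl G i j k x = ctr G x (fun l m => cov4 G (Weyl G) m i j k l x) := rfl
  rw [e]
  simp only [hG.cov4_Weyl hn hx]
  rw [ctr_sub, ctr_add, ctr_sub, ctr_sub, hG.div_Rm hx, ctr_mul_left, ctr_mul_left,
    hG.div_schouten hn hx, hG.div_schouten hn hx,
    hG.ctr_metric_mul' hx (fun m => cov2 G (schouten G) m j k x) i,
    hG.ctr_metric_mul' hx (fun m => cov2 G (schouten G) m i k x) j,
    hG.cov2_schouten hx, hG.cov2_schouten hx, Cotton]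
  field_simp
  ring

lemma Weyl_antisymm_right (hn : 3 ≤ n) (hG : IsMetricOn G U) (hx : x ∈ U) (i j k l : Fin n) :
    Weyl G i j k l x = - Weyl G i j l k x := by
  rw [Weyl_eq_schouten hn, Weyl_eq_schouten hn, hG.Rm_antisymm_right hx]; ring

lemma Weyl_pair_symm (hn : 3 ≤ n) (hG : IsMetricOn G U) (hx : x ∈ U) (i j k l : Fin n) :
    Weyl G i j k l x = Weyl G k l i j x := by
  rw [Weyl_eq_schouten hn, Weyl_eq_schouten hn, hG.Rm_pair_symm hx, hG.symm hx i k,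
    hG.symm hx i l, hG.symm hx j k, hG.symm hx j l, hG.schouten_symm hx j l,
    hG.schouten_symm hx j k, hG.schouten_symm hx i l, hG.schouten_symm hx i k]
  ring

lemma ctr_schouten (hn : 3 ≤ n) (hG : IsMetricOn G U) (hx : x ∈ U) :
    ctr G x (fun j l => schouten G j l x) = 1 / (2 * ((n : ℝ) - 1)) * Scal G x := by
  have h1 := natCast_sub_one_ne hn
  have h2 := natCast_sub_two_ne hn
  simp only [schouten]
  rw [ctr_mul_left, ctr_sub, ctr_mul_left, ctr_mul_left (Scal G x) (fun j l => G x j l),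
    hG.ctr_metric hx, ← Scal_eq_ctr]
  field_simp
  ring

lemma ctr_Weyl (hn : 3 ≤ n) (hG : IsMetricOn G U) (hx : x ∈ U) (i k : Fin n) :
    ctr G x (fun j l => Weyl G i j k l x) = 0 := by
  have h1 := natCast_sub_one_ne hn
  have h2 := natCast_sub_two_ne hn
  simp only [Weyl_eq_schouten hn]
  rw [ctr_sub, ctr_add, ctr_sub, ctr_sub, ← Ric_eq_ctr, ctr_mul_left, hG.ctr_schouten hn hx,
    ctr_mul_right (schouten G i k x) (fun j l => G x j l), hG.ctr_metric hx]
  have e1 : ctr G x (fun j l => G x i l * schouten G j k x) = schouten G i k x := by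
    rw [← hG.ctr_swap hx]
    exact hG.ctr_metric_mul' hx (fun j => schouten G j k x) i
  rw [e1, hG.ctr_metric_mul hx (fun l => schouten G i l x) k, schouten]
  field_simp
  ring

lemma Weyl_eq_zero_of_dim_three (h3 : n = 3) (hG : IsMetricOn G U) (hx : x ∈ U)
    (i j k l : Fin n) : Weyl G i j k l x = 0 := by
  subst h3
  refine curvatureLike_eq_zero_of_dim_three (fun i j => gInv G i j x)
    (fun i j k l => Weyl G i j k l x) (hG.gInv_symm hx) ?_
    (Weyl_antisymm_left le_rfl) (hG.Weyl_antisymm_right le_rfl hx)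
    (hG.Weyl_pair_symm le_rfl hx) (hG.ctr_Weyl le_rfl hx) i j k l
  exact (hG.posDef x hx).inv.det_pos.ne'

lemma ctr_Cotton (hn : 3 ≤ n) (hG : IsMetricOn G U) (hx : x ∈ U) (i : Fin n) :
    ctr G x (fun j k => Cotton G i j k x) = 0 := by
  have h1 := natCast_sub_one_ne hn
  have e1 : ctr G x (fun j k => cov2 G (Ric G) j i k x) = 1 / 2 * pd i (Scal G) x := by
    rw [← hG.div_Ric hx, ← hG.ctr_swap hx]
  have e2 : ctr G x (fun j k => G x i k * pd j (Scal G) x) = pd i (Scal G) x := by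
    rw [← hG.ctr_swap hx]
    exact hG.ctr_metric_mul' hx (fun j => pd j (Scal G) x) i
  simp only [Cotton]
  rw [ctr_sub, ctr_sub, ctr_mul_left, ctr_sub,
    ctr_mul_right (pd i (Scal G) x) (fun j k => G x j k), hG.ctr_cov2_Ric hx, e1, e2,
    hG.ctr_metric hx]
  field_simp
  ring

lemma cov3_swap_const_mul (hG : IsMetricOn G U) (hx : x ∈ U) (c : ℝ)
    {T T' : Fin n → Fin n → Fin n → EuclideanSpace ℝ (Fin n) → ℝ}
    (hT : ∀ i j k, ContDiffOn ℝ ∞ (T i j k) U)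
    (h : ∀ y ∈ U, ∀ i j k, T' i j k y = c * T j i k y) (m i j k : Fin n) :
    cov3 G T' m i j k x = c * cov3 G T m j i k x := by
  simp only [cov3]
  rw [pd_congr m hG.isOpen hx fun y hy => h y hy i j k,
    pd_const_mul m c (diffAt hG.isOpen (hT j i k) hx)]
  simp only [h x hx, sum_mul_const_mul]
  ring

/-- The formula `B_{ij} = (n-2)⁻¹ (∇^k C_{kij} + R^{kl} W_{ikjl})`, valid in every dimension
`n ≥ 3`. -/
lemma Bach_eq (hn : 3 ≤ n) (hG : IsMetricOn G U) (hx : x ∈ U) (i j : Fin n) :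
    Bach G i j x = 1 / ((n : ℝ) - 2) * (ctr G x (fun k m => cov3 G (Cotton G) m k i j x)
      + ∑ a, ∑ b, ricUp G a b x * Weyl G i a j b x) := by
  have h2 := natCast_sub_two_ne hn
  by_cases h3 : n = 3
  · have hc : (n : ℝ) - 2 = 1 := by rw [h3]; norm_num
    simp only [hG.Weyl_eq_zero_of_dim_three h3 hx, mul_zero, Finset.sum_const_zero, hc]
    simp [Bach, h3, ctr]
  · have hc : (n : ℝ) - 3 ≠ 0 := by
      intro h; apply h3; exact_mod_cast (sub_eq_zero.1 h)
    have e1 : ctr G x (fun k m => cov3 G (divWeyl G) m i k j x)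
        = ((n : ℝ) - 3) / ((n : ℝ) - 2) * ctr G x (fun k m => cov3 G (Cotton G) m k i j x) := by
      rw [← ctr_mul_left]
      refine ctr_congr fun k m => hG.cov3_swap_const_mul hx _ hG.contDiffOn_Cotton ?_ _ _ _ _
      intro y hy a b c
      rw [hG.divWeyl_eq_Cotton hn hy, Cotton_antisymm]; ring
    have e2 : ∑ k, ∑ l, ∑ a, ∑ b, Ric G k l x * gInv G k a x * gInv G l b x * Weyl G i a j b x
        = ∑ a, ∑ b, ricUp G a b x * Weyl G i a j b x := by
      simp only [ricUp, Finset.sum_mul]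
      have : ∀ F : Fin n → Fin n → Fin n → Fin n → ℝ,
          ∑ k, ∑ l, ∑ a, ∑ b, F k l a b = ∑ a, ∑ b, ∑ k, ∑ l, F k l a b := by
        intro F
        have h : ∀ H : Fin n → Fin n → ℝ, ∑ k, ∑ l, H k l = ∑ p : Fin n × Fin n, H p.1 p.2 :=
          fun H => by rw [← Finset.sum_product', Finset.univ_product_univ]
        simp only [h]
        exact Finset.sum_comm
      exact this _
    have e3 : Bach G i j x = 1 / ((n : ℝ) - 3) * ctr G x (fun k m => cov3 G (divWeyl G) m i k j x)
        + 1 / ((n : ℝ) - 2) * ∑ k, ∑ l, ∑ a, ∑ b,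
          Ric G k l x * gInv G k a x * gInv G l b x * Weyl G i a j b x := by
      simp only [Bach, h3, if_false, ctr]
    rw [e3, e1, e2]
    field_simp

end IsMetricOn

/-! ### The gradient and the Ricci identity -/

lemma sum_mul_grad (T : Fin n → ℝ) :
    ∑ k, T k * grad G u k x = ctr G x (fun k m => T k * pd m u x) := by
  simp only [ctr, grad, Finset.mul_sum]
  exact Finset.sum_congr rfl fun _ _ => Finset.sum_congr rfl fun _ _ => by ring

namespace IsMetricOn

lemma sum_metric_mul_grad (hG : IsMetricOn G U) (hx : x ∈ U) (j : Fin n) :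
    ∑ l, G x j l * grad G u l x = pd j u x := by
  have h : (G x).mulVec ((G x)⁻¹.mulVec fun j => pd j u x) = fun j => pd j u x := by
    rw [Matrix.mulVec_mulVec, Matrix.mul_nonsing_inv _ (hG.isUnit_det hx), Matrix.one_mulVec]
  exact congrFun h j

/-- The Ricci identity for covector fields. -/
lemma cov2_cov1_sub (hG : IsMetricOn G U) (hx : x ∈ U)
    {T : Fin n → EuclideanSpace ℝ (Fin n) → ℝ} (hT : ∀ j, ContDiffOn ℝ ∞ (T j) U)
    (i j k : Fin n) :
    cov2 G (cov1 G T) i j k x - cov2 G (cov1 G T) j i k x = ∑ r, Rm13 G i j k r x * T r x := by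
  have hU := hG.isOpen
  have dG := fun s a b => diffAt hU (hG.contDiffOn_Gam s a b) hx
  have dT := fun a => diffAt hU (hT a) hx
  have key : ∀ a b, pd a (cov1 G T b k) x = pd a (pd b (T k)) x
      - (∑ s, pd a (Gam G s b k) x * T s x + ∑ s, Gam G s b k x * pd a (T s) x) := by
    intro a b
    have e : cov1 G T b k = fun y => pd b (T k) y - ∑ s, Gam G s b k y * T s y := rfl
    rw [e, pd_sub a (diffAt hU (contDiffOn_pd hU (hT k) b) hx)
      (DifferentiableAt.fun_sum fun s _ => (dG s b k).fun_mul (dT s)),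
      pd_sum _ _ (fun s y => Gam G s b k y * T s y) fun s _ => (dG s b k).mul (dT s),
      ← Finset.sum_add_distrib]
    congr 1
    exact Finset.sum_congr rfl fun s _ => pd_mul a (dG s b k) (dT s)
  have e2 : ∀ a b, ∑ s, Gam G s a k x * cov1 G T b s x = ∑ s, Gam G s a k x * pd b (T s) x
      - ∑ r, (∑ s, Gam G s a k x * Gam G r b s x) * T r x := by
    intro a b
    simp only [cov1, mul_sub, Finset.sum_sub_distrib, Finset.mul_sum, Finset.sum_mul]
    congr 1
    rw [Finset.sum_comm]
    exact Finset.sum_congr rfl fun _ _ => Finset.sum_congr rfl fun _ _ => by ring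
  simp only [cov2]
  rw [key, key, pd_comm hU (hT k) hx i j, e2, e2]
  simp only [hG.Gam_symm hx _ j i, Rm13, add_mul, sub_mul, Finset.sum_add_distrib,
    Finset.sum_sub_distrib]
  ring

lemma sum_Rm13_mul_pd (hG : IsMetricOn G U) (hx : x ∈ U) (i j k : Fin n) :
    ∑ r, Rm13 G i j k r x * pd r u x = ∑ l, Rm G i j k l x * grad G u l x := by
  simp only [Rm, Finset.sum_mul]
  rw [Finset.sum_comm]
  refine Finset.sum_congr rfl fun r _ => ?_
  rw [← hG.sum_metric_mul_grad hx, Finset.mul_sum]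
  exact Finset.sum_congr rfl fun l _ => by rw [hG.symm hx r l]; ring

lemma pd_grad (hG : IsMetricOn G U) (hx : x ∈ U) (hu : ContDiffOn ℝ ∞ u U) (m k : Fin n) :
    pd m (grad G u k) x
      = - ∑ s, Gam G k m s x * grad G u s x + ∑ s, gInv G k s x * hess G u m s x := by
  have hU := hG.isOpen
  have dI := fun s => diffAt hU (hG.contDiffOn_gInv k s) hx
  have dp := fun s => diffAt hU (contDiffOn_pd hU hu s) hx
  have e : grad G u k = fun y => ∑ s, gInv G k s y * pd s u y := rfl
  rw [e, pd_sum _ _ (fun s y => gInv G k s y * pd s u y) fun s _ => (dI s).mul (dp s)]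
  have e2 : ∀ s, pd m (fun y => gInv G k s y * pd s u y) x
      = (- ∑ r, Gam G k m r x * gInv G r s x - ∑ r, Gam G s m r x * gInv G k r x) * pd s u x
        + gInv G k s x * pd m (pd s u) x := fun s => by
    rw [pd_mul m (dI s) (dp s), hG.pd_gInv hx]
  simp only [e2, grad, hess, cov1, mul_sub, sub_mul, neg_mul, Finset.sum_add_distrib,
    Finset.sum_sub_distrib, Finset.sum_neg_distrib, Finset.mul_sum, Finset.sum_mul]
  have e3 : ∑ s, ∑ r, Gam G k m r x * gInv G r s x * pd s u x
      = ∑ s, ∑ r, Gam G k m s x * (gInv G s r x * pd r u x) := by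
    rw [Finset.sum_comm]
    exact Finset.sum_congr rfl fun _ _ => Finset.sum_congr rfl fun _ _ => by ring
  have e4 : ∑ s, ∑ r, Gam G s m r x * gInv G k r x * pd s u x
      = ∑ s, ∑ r, gInv G k s x * (Gam G r m s x * pd r u x) := by
    rw [Finset.sum_comm]
    exact Finset.sum_congr rfl fun _ _ => Finset.sum_congr rfl fun _ _ => by ring
  rw [e3, e4]
  ring

end IsMetricOn

/-! ### Gradient `ρ`-Einstein solitons in coordinates -/

/-- The covector `R_{il} ∇^l u`. -/
def ricGrad (G : EuclideanSpace ℝ (Fin n) → Matrix (Fin n) (Fin n) ℝ)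
    (u : EuclideanSpace ℝ (Fin n) → ℝ) (i : Fin n) (x : EuclideanSpace ℝ (Fin n)) : ℝ :=
  ∑ l, Ric G i l x * grad G u l x

/-- The squared length `|∇u|²`. -/
def gradSq (G : EuclideanSpace ℝ (Fin n) → Matrix (Fin n) (Fin n) ℝ)
    (u : EuclideanSpace ℝ (Fin n) → ℝ) (x : EuclideanSpace ℝ (Fin n)) : ℝ :=
  ∑ k, pd k u x * grad G u k x

/-- On the open set `U`, `G` is a metric and `u` a smooth solution of the `ρ`-Einstein soliton
equation. -/
structure IsSolitonOn (G : EuclideanSpace ℝ (Fin n) → Matrix (Fin n) (Fin n) ℝ)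
    (u : EuclideanSpace ℝ (Fin n) → ℝ) (ρ lam : ℝ) (U : Set (EuclideanSpace ℝ (Fin n))) : Prop
    extends IsMetricOn G U where
  smooth_potential : ContDiffOn ℝ ∞ u U
  equation : ∀ x ∈ U, ∀ i j : Fin n,
    Ric G i j x + hess G u i j x = (ρ * Scal G x + lam) * G x i j

namespace IsSolitonOn

variable {ρ lam : ℝ}

lemma mono {V : Set (EuclideanSpace ℝ (Fin n))} (hS : IsSolitonOn G u ρ lam U) (hV : IsOpen V)
    (hVU : V ⊆ U) : IsSolitonOn G u ρ lam V :=
  ⟨hS.toIsMetricOn.mono hV hVU, hS.smooth_potential.mono hVU, fun x hx => hS.equation x (hVU hx)⟩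

lemma hess_eq (hS : IsSolitonOn G u ρ lam U) (hx : x ∈ U) (i j : Fin n) :
    hess G u i j x = (ρ * Scal G x + lam) * G x i j - Ric G i j x := by
  linarith [hS.equation x hx i j]

lemma cov2_hess (hS : IsSolitonOn G u ρ lam U) (hx : x ∈ U) (i j k : Fin n) :
    cov2 G (hess G u) i j k x = ρ * pd i (Scal G) x * G x j k - cov2 G (Ric G) i j k x := by
  have hG := hS.toIsMetricOn
  have hU := hG.isOpen
  have hsc : ContDiffOn ℝ ∞ (fun y => ρ * Scal G y + lam) U :=
    (contDiffOn_const.mul hG.contDiffOn_Scal).add contDiffOn_const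
  have h1 : pd i (fun y => ρ * Scal G y + lam) x = ρ * pd i (Scal G) x := by
    rw [pd_add i (diffAt hU (contDiffOn_const.mul hG.contDiffOn_Scal) hx)
      (differentiableAt_const _), pd_const_mul i ρ (diffAt hU hG.contDiffOn_Scal hx)]
    simp
  have h2 := hG.cov2_mul_metric hx hsc i j k
  have h3 : pd i (hess G u j k) x
      = pd i (fun y => (ρ * Scal G y + lam) * G y j k) x - pd i (Ric G j k) x := by
    rw [pd_congr i hU hx fun y hy => hS.hess_eq hy j k,
      pd_sub i (diffAt hU (hsc.mul (hG.smooth j k)) hx) (diffAt hU (hG.contDiffOn_Ric j k) hx)]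
  simp only [cov2, hS.hess_eq hx, mul_sub, Finset.sum_sub_distrib]
  rw [h3, ← h1, ← h2]
  ring

lemma sum_Rm_mul_grad (hS : IsSolitonOn G u ρ lam U) (hx : x ∈ U) (i j k : Fin n) :
    ∑ l, Rm G i j k l x * grad G u l x
      = ρ * pd i (Scal G) x * G x j k - ρ * pd j (Scal G) x * G x i k
        - (cov2 G (Ric G) i j k x - cov2 G (Ric G) j i k x) := by
  have hG := hS.toIsMetricOn
  have h : cov2 G (hess G u) i j k x - cov2 G (hess G u) j i k x
      = ∑ r, Rm13 G i j k r x * pd r u x :=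
    hG.cov2_cov1_sub hx (fun k => contDiffOn_pd hG.isOpen hS.smooth_potential k) i j k
  rw [← hG.sum_Rm13_mul_pd hx, ← h, hS.cov2_hess hx, hS.cov2_hess hx]
  ring

/-- `Ric(∇f) = (½ - (n-1)ρ) dR`. -/
lemma ricGrad_eq (hS : IsSolitonOn G u ρ lam U) (hx : x ∈ U) (i : Fin n) :
    ricGrad G u i x = (1 / 2 - ((n : ℝ) - 1) * ρ) * pd i (Scal G) x := by
  have hG := hS.toIsMetricOn
  have h1 : ctr G x (fun j k => ∑ l, Rm G i j k l x * grad G u l x) = - ricGrad G u i x := by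
    rw [ctr_sum, ricGrad, ← Finset.sum_neg_distrib]
    refine Finset.sum_congr rfl fun l _ => ?_
    rw [ctr_mul_right (grad G u l x) (fun j k => Rm G i j k l x), Ric_eq_ctr, ← neg_mul, ← ctr_neg]
    congr 1
    exact ctr_congr fun j k => hG.Rm_antisymm_right hx _ _ _ _
  have e2 : ctr G x (fun j k => ρ * pd j (Scal G) x * G x i k) = ρ * pd i (Scal G) x :=
    hG.ctr_mul_metric' hx (fun j => ρ * pd j (Scal G) x) i
  have e3 : ctr G x (fun j k => cov2 G (Ric G) j i k x) = 1 / 2 * pd i (Scal G) x := by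
    rw [← hG.div_Ric hx, ← hG.ctr_swap hx]
  simp only [hS.sum_Rm_mul_grad hx] at h1
  rw [ctr_sub, ctr_sub, ctr_sub, e2, e3, hG.ctr_cov2_Ric hx,
    ctr_mul_left (ρ * pd i (Scal G) x) (fun j k => G x j k), hG.ctr_metric hx] at h1
  linear_combination h1

/-- The Cotton tensor of a soliton. The constants `ρ` and `λ` enter only through
`Ric(∇f)`. -/
lemma Cotton_eq (hn : 3 ≤ n) (hS : IsSolitonOn G u ρ lam U) (hx : x ∈ U) (i j k : Fin n) :
    Cotton G i j k x = - ∑ l, Rm G i j k l x * grad G u l x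
      - 1 / ((n : ℝ) - 1) * (ricGrad G u i x * G x j k - ricGrad G u j x * G x i k) := by
  have h1 := natCast_sub_one_ne hn
  rw [hS.sum_Rm_mul_grad hx, hS.ricGrad_eq hx, hS.ricGrad_eq hx, Cotton]
  field_simp
  ring

lemma contDiffOn_gradSq (hS : IsSolitonOn G u ρ lam U) : ContDiffOn ℝ ∞ (gradSq G u) U :=
  ContDiffOn.sum fun k _ => (contDiffOn_pd hS.isOpen hS.smooth_potential k).mul
    (hS.toIsMetricOn.contDiffOn_grad hS.smooth_potential k)

lemma half_pd_gradSq (hS : IsSolitonOn G u ρ lam U) (hx : x ∈ U) (i : Fin n) :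
    1 / 2 * pd i (gradSq G u) x = (ρ * Scal G x + lam) * pd i u x - ricGrad G u i x := by
  have hG := hS.toIsMetricOn
  have hU := hG.isOpen
  have hp := fun k => contDiffOn_pd hU hS.smooth_potential k
  have e : gradSq G u = fun y => ctr G y (fun k m => pd k u y * pd m u y) := by
    funext y; exact sum_mul_grad _
  have h : pd i (gradSq G u) x
      = ctr G x (fun k m => cov2 G (fun k m y => pd k u y * pd m u y) i k m x) := by
    rw [e]; exact hG.pd_ctr hx i fun k m => (hp k).mul (hp m)
  have h2 : ∀ k m, cov2 G (fun k m y => pd k u y * pd m u y) i k m x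
      = hess G u i k x * pd m u x + pd k u x * hess G u i m x := by
    intro k m
    simp only [cov2, hess, cov1]
    rw [pd_mul i (diffAt hU (hp k) hx) (diffAt hU (hp m) hx), sum_mul_const_mul, sum_mul_mul_const]
    ring
  have h3 : ctr G x (fun k m => pd k u x * hess G u i m x)
      = ctr G x (fun k m => hess G u i k x * pd m u x) := by
    rw [← hG.ctr_swap hx]; exact ctr_congr fun _ _ => mul_comm _ _
  simp only [h2] at h
  rw [ctr_add, h3, ← sum_mul_grad (fun k => hess G u i k x)] at h
  rw [h]
  simp only [hS.hess_eq hx, sub_mul, Finset.sum_sub_distrib, mul_assoc, ← Finset.mul_sum,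
    hG.sum_metric_mul_grad hx, ricGrad]
  ring

/-- `dR ∧ df = 0` when `ρ ≠ 0`: the form `(ρR + λ) df - Ric(∇f)` is exact, and `Ric(∇f)` is a
multiple of `dR`. -/
lemma pd_Scal_wedge (hS : IsSolitonOn G u ρ lam U) (hρ : ρ ≠ 0) (hx : x ∈ U) (i j : Fin n) :
    pd i (Scal G) x * pd j u x - pd j (Scal G) x * pd i u x = 0 := by
  have hG := hS.toIsMetricOn
  have hU := hG.isOpen
  have hR := hG.contDiffOn_Scal
  have hp := fun k => contDiffOn_pd hU hS.smooth_potential k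
  have hpR := fun k => contDiffOn_pd hU hR k
  set c : ℝ := 1 / 2 - ((n : ℝ) - 1) * ρ with hc
  have key : ∀ a b, 1 / 2 * pd a (pd b (gradSq G u)) x
      = ρ * pd a (Scal G) x * pd b u x + (ρ * Scal G x + lam) * pd a (pd b u) x
        - c * pd a (pd b (Scal G)) x := by
    intro a b
    have h1 : ∀ y ∈ U, 1 / 2 * pd b (gradSq G u) y
        = (ρ * Scal G y + lam) * pd b u y - c * pd b (Scal G) y := fun y hy => by
      rw [hS.half_pd_gradSq hy, hS.ricGrad_eq hy]
    have h2 := pd_congr a hU hx h1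
    have d1 := diffAt hU ((contDiffOn_const (c := ρ)).mul hR) hx
    have d2 := d1.fun_add (differentiableAt_const lam)
    rw [pd_const_mul a _ (diffAt hU (contDiffOn_pd hU hS.contDiffOn_gradSq b) hx),
      pd_sub a (d2.fun_mul (diffAt hU (hp b) hx)) (diffAt hU (contDiffOn_const.mul (hpR b)) hx),
      pd_mul a d2 (diffAt hU (hp b) hx), pd_add a d1 (differentiableAt_const lam),
      pd_const_mul a ρ (diffAt hU hR hx), pd_const_mul a c (diffAt hU (hpR b) hx)] at h2
    rw [h2, pd_const]; ring
  have k1 := key i j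
  have k2 := key j i
  rw [pd_comm hU hS.contDiffOn_gradSq hx i j, pd_comm hU hS.smooth_potential hx i j,
    pd_comm hU hR hx i j] at k1
  apply mul_left_cancel₀ hρ
  linear_combination k2 - k1

end IsSolitonOn

/-! ### Raising both indices of a 2-tensor -/

/-- The contravariant components `T^{ab}` of a covariant 2-tensor `T` at the point `x`. -/
def raise (G : EuclideanSpace ℝ (Fin n) → Matrix (Fin n) (Fin n) ℝ)
    (x : EuclideanSpace ℝ (Fin n)) (T : Fin n → Fin n → ℝ) (a b : Fin n) : ℝ :=
  ∑ k, ∑ l, T k l * gInv G k a x * gInv G l b x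

lemma ricUp_eq_raise (a b : Fin n) :
    ricUp G a b x = raise G x (fun k l => Ric G k l x) a b := rfl

open scoped MatrixOrder Matrix.Norms.L2Operator in
lemma _root_.Matrix.PosSemidef.exists_eq_transpose_mul_self {A : Matrix (Fin n) (Fin n) ℝ}
    (hA : A.PosSemidef) : ∃ B : Matrix (Fin n) (Fin n) ℝ, A = B.transpose * B := by
  obtain ⟨B, hB⟩ := CStarAlgebra.nonneg_iff_eq_star_mul_self.mp hA.nonneg
  exact ⟨B, by rw [hB, Matrix.star_eq_conjTranspose, Matrix.conjTranspose_eq_transpose_of_trivial]⟩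

/-- Definiteness of the squared length `T^{ab} T_{ab}`: for `g⁻¹ = Bᵀ B` it is the squared Frobenius
norm of `B T Bᵀ`. -/
lemma eq_zero_of_sum_raise_mul_nonpos (hG : IsMetricOn G U) (hx : x ∈ U)
    (T : Fin n → Fin n → ℝ) (h : ∑ a, ∑ b, raise G x T a b * T a b ≤ 0) (i j : Fin n) :
    T i j = 0 := by
  have hpd := (hG.posDef x hx).inv
  obtain ⟨B, hB⟩ := hpd.posSemidef.exists_eq_transpose_mul_self
  set M : Matrix (Fin n) (Fin n) ℝ := Matrix.of T with hM
  have hsym : ((G x)⁻¹).transpose = (G x)⁻¹ := by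
    rw [hB, Matrix.transpose_mul, Matrix.transpose_transpose]
  have h1 : ∑ a, ∑ b, raise G x T a b * T a b
      = ((B * M * B.transpose).transpose * (B * M * B.transpose)).trace := by
    have e1 : ∀ a b, raise G x T a b = ((G x)⁻¹ * M * (G x)⁻¹) a b := by
      intro a b
      simp only [raise, Matrix.mul_apply, Finset.sum_mul]
      rw [Finset.sum_comm]
      refine Finset.sum_congr rfl fun l _ => Finset.sum_congr rfl fun k _ => ?_
      rw [hG.gInv_symm hx k a]
      simp only [hM, Matrix.of_apply, gInv]; ring
    have e2 : ((B * M * B.transpose).transpose * (B * M * B.transpose)).trace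
        = (((G x)⁻¹ * M * (G x)⁻¹).transpose * M).trace := by
      have e3 : ((G x)⁻¹ * M * (G x)⁻¹).transpose
          = (B.transpose * B) * M.transpose * (B.transpose * B) := by
        rw [Matrix.transpose_mul, Matrix.transpose_mul, hsym, hB]; noncomm_ring
      rw [e3, Matrix.transpose_mul, Matrix.transpose_mul, Matrix.transpose_transpose]
      have e4 : B * (M.transpose * B.transpose) * (B * M * B.transpose)
          = (B * M.transpose * B.transpose * B * M) * B.transpose := by noncomm_ring
      rw [e4, Matrix.trace_mul_comm]
      congr 1; noncomm_ring
    have e5 : ∀ N : Matrix (Fin n) (Fin n) ℝ,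
        (N.transpose * M).trace = ∑ a, ∑ b, N a b * M a b := by
      intro N
      simp only [Matrix.trace, Matrix.diag, Matrix.mul_apply, Matrix.transpose_apply]
      exact Finset.sum_comm
    rw [e2, e5]
    simp only [e1]
    rfl
  have h2 : (B * M * B.transpose) = 0 := by
    rw [h1] at h
    have hps := Matrix.posSemidef_conjTranspose_mul_self (B * M * B.transpose)
    have h0 := hps.trace_nonneg
    simp only [Matrix.conjTranspose_eq_transpose_of_trivial] at h0
    have := Matrix.trace_conjTranspose_mul_self_eq_zero_iff (A := B * M * B.transpose)
    simp only [Matrix.conjTranspose_eq_transpose_of_trivial] at this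
    exact this.1 (le_antisymm h h0)
  have h3 : (G x)⁻¹ * M * (G x)⁻¹ = 0 := by
    have : (G x)⁻¹ * M * (G x)⁻¹ = B.transpose * (B * M * B.transpose) * B := by
      rw [hB]; noncomm_ring
    rw [this, h2]; simp
  have h4 : M = G x * ((G x)⁻¹ * M * (G x)⁻¹) * G x := by
    rw [Matrix.mul_assoc (G x)⁻¹, Matrix.mul_nonsing_inv_cancel_left _ _ (hG.isUnit_det hx),
      Matrix.mul_assoc, Matrix.nonsing_inv_mul _ (hG.isUnit_det hx), Matrix.mul_one]
  rw [h3] at h4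
  have := congrFun (congrFun h4 i) j
  simpa [hM] using this

namespace IsMetricOn

lemma gradSq_nonneg (hG : IsMetricOn G U) (hx : x ∈ U) : 0 ≤ gradSq G u x := by
  have := (hG.posDef x hx).inv.posSemidef.dotProduct_mulVec_nonneg (fun k => pd k u x)
  simpa [gradSq, dotProduct, Matrix.mulVec, grad, gInv] using this

lemma pd_eq_zero_of_gradSq (hG : IsMetricOn G U) (hx : x ∈ U) (h : gradSq G u x = 0) (k : Fin n) :
    pd k u x = 0 := by
  by_contra hk
  have hne : (fun k => pd k u x) ≠ 0 := fun h0 => hk (congrFun h0 k)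
  have := (hG.posDef x hx).inv.dotProduct_mulVec_pos hne
  have h2 : 0 < gradSq G u x := by
    simpa [gradSq, dotProduct, Matrix.mulVec, grad, gInv] using this
  exact h2.ne' h

lemma raise_metric (hG : IsMetricOn G U) (hx : x ∈ U) (a b : Fin n) :
    raise G x (fun k l => G x k l) a b = gInv G a b x := by
  have : ∀ l, ∑ k, G x k l * gInv G k a x * gInv G l b x
      = (if a = l then 1 else 0) * gInv G l b x := by
    intro l
    rw [← Finset.sum_mul, ← hG.sum_gInv_mul hx]
    congr 1
    exact Finset.sum_congr rfl fun k _ => by rw [hG.gInv_symm hx k a, mul_comm]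
  rw [raise, Finset.sum_comm]
  simp [this]

lemma raise_pd (hG : IsMetricOn G U) (hx : x ∈ U) (a b : Fin n) :
    raise G x (fun k l => pd k u x * pd l u x) a b = grad G u a x * grad G u b x := by
  simp only [raise, grad, Finset.sum_mul_sum]
  refine Finset.sum_congr rfl fun k _ => Finset.sum_congr rfl fun l _ => ?_
  rw [hG.gInv_symm hx k a, hG.gInv_symm hx l b]; ring

end IsMetricOn

/-- The tensor `Ric - αg - β du ⊗ du`. When `∇u` is a Ricci eigenvector with eigenvalue `μ`, it is
used with `α = (R - μ)/(n-1)` and `β = (nμ - R)/((n-1)|∇u|²)`, the choice that makes it trace-free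
and orthogonal to `∇u`. -/
def ricDefect (G : EuclideanSpace ℝ (Fin n) → Matrix (Fin n) (Fin n) ℝ)
    (u : EuclideanSpace ℝ (Fin n) → ℝ) (α β : ℝ) (x : EuclideanSpace ℝ (Fin n))
    (k l : Fin n) : ℝ :=
  Ric G k l x - α * G x k l - β * (pd k u x * pd l u x)

lemma ricUp_eq (hG : IsMetricOn G U) (hx : x ∈ U) (α β : ℝ) (a b : Fin n) :
    ricUp G a b x = raise G x (ricDefect G u α β x) a b + α * gInv G a b x
      + β * (grad G u a x * grad G u b x) := by
  rw [← hG.raise_metric hx, ← hG.raise_pd hx, ricUp_eq_raise]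
  simp only [raise, ricDefect, Finset.mul_sum, ← Finset.sum_add_distrib]
  exact Finset.sum_congr rfl fun _ _ => Finset.sum_congr rfl fun _ _ => by ring

/-! ### The Bach tensor of a soliton in the radial direction -/

namespace IsSolitonOn

variable {ρ lam : ℝ}

lemma ricGrad_wedge (hS : IsSolitonOn G u ρ lam U) (hx : x ∈ U)
    (hw : ∀ i j, pd i (Scal G) x * pd j u x - pd j (Scal G) x * pd i u x = 0) (i j : Fin n) :
    ricGrad G u i x * pd j u x = ricGrad G u j x * pd i u x := by
  rw [hS.ricGrad_eq hx, hS.ricGrad_eq hx]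
  linear_combination (1 / 2 - ((n : ℝ) - 1) * ρ) * hw i j

/-- `C(·, ·, ∇f) = 0` when `dR ∧ df = 0`. -/
lemma sum_Cotton_mul_grad (hn : 3 ≤ n) (hS : IsSolitonOn G u ρ lam U) (hx : x ∈ U)
    (hw : ∀ i j, pd i (Scal G) x * pd j u x - pd j (Scal G) x * pd i u x = 0) (i j : Fin n) :
    ∑ k, Cotton G i j k x * grad G u k x = 0 := by
  have hG := hS.toIsMetricOn
  have h1 : ∑ k, ∑ l, Rm G i j k l x * grad G u l x * grad G u k x = 0 := by
    have : ∑ k, ∑ l, Rm G i j k l x * grad G u l x * grad G u k x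
        = - ∑ k, ∑ l, Rm G i j k l x * grad G u l x * grad G u k x := by
      conv_lhs => rw [Finset.sum_comm]
      simp only [← Finset.sum_neg_distrib]
      exact Finset.sum_congr rfl fun k _ => Finset.sum_congr rfl fun l _ => by
        rw [hG.Rm_antisymm_right hx i j l k]; ring
    linarith
  have h2 : ∀ k, Cotton G i j k x * grad G u k x
      = - ∑ l, Rm G i j k l x * grad G u l x * grad G u k x
        - 1 / ((n : ℝ) - 1) * (ricGrad G u i x * (G x j k * grad G u k x)
          - ricGrad G u j x * (G x i k * grad G u k x)) := fun k => by
    rw [hS.Cotton_eq hn hx, ← Finset.sum_mul]; ring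
  simp only [h2, Finset.sum_sub_distrib, Finset.sum_neg_distrib, ← Finset.mul_sum,
    hG.sum_metric_mul_grad hx, h1]
  rw [hS.ricGrad_wedge hx hw i j]; ring

lemma sum_cov3_Cotton_mul_grad (hn : 3 ≤ n) (hS : IsSolitonOn G u ρ lam U) (hx : x ∈ U)
    (hw : ∀ x ∈ U, ∀ i j, pd i (Scal G) x * pd j u x - pd j (Scal G) x * pd i u x = 0)
    (m i j : Fin n) :
    ∑ k, cov3 G (Cotton G) m i j k x * grad G u k x
      = - ∑ k, Cotton G i j k x * ∑ s, gInv G k s x * hess G u m s x := by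
  have hG := hS.toIsMetricOn
  have hU := hG.isOpen
  have hC := hG.contDiffOn_Cotton
  have hg := hG.contDiffOn_grad hS.smooth_potential
  have h0 : ∀ y ∈ U, ∀ a b, ∑ k, Cotton G a b k y * grad G u k y = 0 := fun y hy =>
    hS.sum_Cotton_mul_grad hn hy (hw y hy)
  have h1 : ∑ k, (pd m (Cotton G i j k) x * grad G u k x
      + Cotton G i j k x * pd m (grad G u k) x) = 0 := by
    have := pd_congr m hU hx fun y hy => h0 y hy i j
    rw [pd_const, pd_sum _ _ (fun k y => Cotton G i j k y * grad G u k y) fun k _ =>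
      (diffAt hU (hC i j k) hx).mul (diffAt hU (hg k) hx)] at this
    rw [← this]
    exact Finset.sum_congr rfl fun k _ =>
      (pd_mul m (diffAt hU (hC i j k) hx) (diffAt hU (hg k) hx)).symm
  have e1 : ∀ F : Fin n → Fin n → ℝ, (∀ s, ∑ k, F s k * grad G u k x = 0) → ∀ a : Fin n → ℝ,
      ∑ k, (∑ s, a s * F s k) * grad G u k x = 0 := by
    intro F hF a
    simp only [Finset.sum_mul]
    rw [Finset.sum_comm]
    refine Finset.sum_eq_zero fun s _ => ?_
    rw [← mul_zero (a s), ← hF s, Finset.mul_sum]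
    exact Finset.sum_congr rfl fun _ _ => by ring
  have e2 : ∑ k, (∑ s, Gam G s m k x * Cotton G i j s x) * grad G u k x
      = ∑ k, Cotton G i j k x * ∑ s, Gam G k m s x * grad G u s x := by
    simp only [Finset.sum_mul, Finset.mul_sum]
    rw [Finset.sum_comm]
    exact Finset.sum_congr rfl fun _ _ => Finset.sum_congr rfl fun _ _ => by ring
  simp only [hG.pd_grad hx hS.smooth_potential, mul_add, mul_neg, Finset.sum_add_distrib,
    Finset.sum_neg_distrib] at h1
  simp only [cov3, sub_mul, Finset.sum_sub_distrib]
  rw [e1 (fun s k => Cotton G s j k x) (fun s => h0 x hx s j),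
    e1 (fun s k => Cotton G i s k x) (fun s => h0 x hx i s), e2]
  linarith

/-- Differentiating `C(·, ·, ∇f) = 0` gives `∇^k C_{kij} ∇^j f = R^{kj} C_{kij}`. -/
lemma sum_div_Cotton_mul_grad (hn : 3 ≤ n) (hS : IsSolitonOn G u ρ lam U) (hx : x ∈ U)
    (hw : ∀ x ∈ U, ∀ i j, pd i (Scal G) x * pd j u x - pd j (Scal G) x * pd i u x = 0)
    (i : Fin n) :
    ∑ j, ctr G x (fun k m => cov3 G (Cotton G) m k i j x) * grad G u j x
      = ∑ k, ∑ j, ricUp G k j x * Cotton G k i j x := by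
  have hG := hS.toIsMetricOn
  have h1 : ∑ j, ctr G x (fun k m => cov3 G (Cotton G) m k i j x) * grad G u j x
      = ctr G x (fun k m => - ∑ j, Cotton G k i j x * ∑ s, gInv G j s x * hess G u m s x) := by
    rw [← ctr_congr fun k m => hS.sum_cov3_Cotton_mul_grad hn hx hw m k i, ctr_sum]
    exact Finset.sum_congr rfl fun j _ => (ctr_mul_right _ _).symm
  have h2 : ∀ m j, ∑ s, gInv G j s x * hess G u m s x
      = (ρ * Scal G x + lam) * (if j = m then 1 else 0) - ∑ s, gInv G j s x * Ric G m s x := by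
    intro m j
    rw [← hG.sum_gInv_mul hx, Finset.mul_sum, ← Finset.sum_sub_distrib]
    exact Finset.sum_congr rfl fun s _ => by rw [hS.hess_eq hx, hG.symm hx m s]; ring
  have h3 : ctr G x (fun k m => Cotton G k i m x) = 0 := by
    have := hG.ctr_Cotton hn hx i
    rw [← neg_eq_zero, ← ctr_neg, ← this]
    exact ctr_congr fun k m => (Cotton_antisymm _ _ _).symm
  have h4 : ∀ k m, - ∑ j, Cotton G k i j x * ∑ s, gInv G j s x * hess G u m s x
      = - (ρ * Scal G x + lam) * Cotton G k i m x
        + ∑ j, Cotton G k i j x * ∑ s, gInv G j s x * Ric G m s x := by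
    intro k m
    simp only [h2, mul_sub, Finset.sum_sub_distrib]
    simp
    ring
  rw [h1, ctr_congr h4, ctr_add, ctr_mul_left, h3, mul_zero, zero_add]
  simp only [ctr, ricUp, Finset.mul_sum, Finset.sum_mul]
  refine Finset.sum_congr rfl fun k _ => ?_
  rw [Finset.sum_comm]
  refine Finset.sum_congr rfl fun j _ => Finset.sum_congr rfl fun m _ =>
    Finset.sum_congr rfl fun s _ => ?_
  rw [hG.gInv_symm hx j s, hG.gInv_symm hx k m]; ring

/-- The curvature terms of `C(·, ∇f, ·)` and `W(∇f, ·, ∇f, ·)` cancel, and what remains is a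
multiple of the defect `Ric - αg - β df ⊗ df`. The hypotheses on `α` and `β` make the defect
trace-free and orthogonal to `∇f`. -/
lemma sum_Cotton_add_Weyl (hn : 3 ≤ n) (hS : IsSolitonOn G u ρ lam U) (hx : x ∈ U) {μ α β : ℝ}
    (hμ : ∀ i, ricGrad G u i x = μ * pd i u x) (hα : ((n : ℝ) - 1) * α = Scal G x - μ)
    (hβ : ((n : ℝ) - 1) * (gradSq G u x * β) = n * μ - Scal G x) (k j : Fin n) :
    ∑ i, grad G u i x * Cotton G k i j x
      + ∑ i, ∑ l, Weyl G i k l j x * grad G u i x * grad G u l x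
      = - (gradSq G u x / ((n : ℝ) - 2)) * ricDefect G u α β x k j := by
  have hG := hS.toIsMetricOn
  have h1 := natCast_sub_one_ne hn
  have h2 := natCast_sub_two_ne hn
  set ν : ℝ := 1 / ((n : ℝ) - 2) * (μ - 1 / (2 * ((n : ℝ) - 1)) * Scal G x) with hν
  have hgw : ∀ a, ∑ l, G x a l * grad G u l x = pd a u x := hG.sum_metric_mul_grad hx
  have hgw' : ∀ a, ∑ l, G x l a * grad G u l x = pd a u x := fun a => by
    rw [← hgw a]; exact Finset.sum_congr rfl fun l _ => by rw [hG.symm hx]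
  have hAw : ∀ a, ∑ l, schouten G a l x * grad G u l x = ν * pd a u x := by
    intro a
    have : ∀ l, schouten G a l x * grad G u l x = 1 / ((n : ℝ) - 2) * (Ric G a l x * grad G u l x)
        - 1 / ((n : ℝ) - 2) * (1 / (2 * ((n : ℝ) - 1)) * Scal G x) * (G x a l * grad G u l x) :=
      fun l => by simp only [schouten]; ring
    simp only [this, Finset.sum_sub_distrib, ← Finset.mul_sum, hgw]
    rw [show ∑ l, Ric G a l x * grad G u l x = μ * pd a u x from hμ a, hν]; ring
  have hAw' : ∀ a, ∑ l, schouten G l a x * grad G u l x = ν * pd a u x := fun a => by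
    rw [← hAw a]; exact Finset.sum_congr rfl fun l _ => by rw [hG.schouten_symm hx]
  have hfw : ∑ i, pd i u x * grad G u i x = gradSq G u x := rfl
  have hW : ∀ i, ∑ l, Weyl G i k l j x * grad G u i x * grad G u l x
      = grad G u i x * (∑ l, Rm G i k l j x * grad G u l x)
        - ((pd i u x * grad G u i x) * schouten G k j x
          - (G x i j * grad G u i x) * (ν * pd k u x)
          - pd k u x * (schouten G i j x * grad G u i x)
          + G x k j * (ν * (pd i u x * grad G u i x))) := by
    intro i
    have : ∀ l, Weyl G i k l j x * grad G u i x * grad G u l x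
        = grad G u i x * (Rm G i k l j x * grad G u l x)
          - (grad G u i x * schouten G k j x * (G x i l * grad G u l x)
          - G x i j * grad G u i x * (schouten G k l x * grad G u l x)
          - schouten G i j x * grad G u i x * (G x k l * grad G u l x)
          + G x k j * grad G u i x * (schouten G i l x * grad G u l x)) := fun l => by
      rw [Weyl_eq_schouten hn]; ring
    simp only [this, Finset.sum_sub_distrib, Finset.sum_add_distrib, ← Finset.mul_sum, hgw, hAw]
    ring
  have hC : ∀ i, grad G u i x * Cotton G k i j x
      = - (grad G u i x * ∑ l, Rm G i k l j x * grad G u l x)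
        - 1 / ((n : ℝ) - 1) * (μ * pd k u x * (G x i j * grad G u i x)
          - μ * G x k j * (pd i u x * grad G u i x)) := by
    intro i
    have : ∑ l, Rm G k i j l x * grad G u l x = ∑ l, Rm G i k l j x * grad G u l x :=
      Finset.sum_congr rfl fun l _ => by
        rw [Rm_antisymm_left, hG.Rm_antisymm_right hx]; ring
    rw [hS.Cotton_eq hn hx, this, hμ, hμ]; ring
  simp only [hC, hW, Finset.sum_sub_distrib, Finset.sum_add_distrib, Finset.sum_neg_distrib,
    ← Finset.mul_sum, ← Finset.sum_mul, hgw', hAw', hfw]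
  have hα' : α = (Scal G x - μ) / ((n : ℝ) - 1) := by rw [← hα]; field_simp
  have hβ' : gradSq G u x * β = (n * μ - Scal G x) / ((n : ℝ) - 1) := by rw [← hβ]; field_simp
  have e : - (gradSq G u x / ((n : ℝ) - 2)) * ricDefect G u α β x k j
      = - (1 / ((n : ℝ) - 2)) * (gradSq G u x * Ric G k j x - gradSq G u x * α * G x k j
        - (gradSq G u x * β) * (pd k u x * pd j u x)) := by
    simp only [ricDefect]; ring
  rw [e, hβ', hα', hν, schouten]
  field_simp
  ring

end IsSolitonOn

namespace IsSolitonOn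

variable {ρ lam : ℝ}

/-- The pointwise formula behind the rigidity: `B(∇f, ∇f)` is `-|∇f|²/(n-2)²` times the product
of the Ricci tensor with its defect `Ric - αg - β df ⊗ df`. -/
lemma sum_Bach_mul_grad (hn : 3 ≤ n) (hS : IsSolitonOn G u ρ lam U) (hx : x ∈ U)
    (hw : ∀ x ∈ U, ∀ i j, pd i (Scal G) x * pd j u x - pd j (Scal G) x * pd i u x = 0) {μ α β : ℝ}
    (hμ : ∀ i, ricGrad G u i x = μ * pd i u x) (hα : ((n : ℝ) - 1) * α = Scal G x - μ)
    (hβ : ((n : ℝ) - 1) * (gradSq G u x * β) = n * μ - Scal G x) :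
    ∑ i, ∑ j, Bach G i j x * grad G u i x * grad G u j x
      = - (gradSq G u x / ((n : ℝ) - 2) ^ 2)
        * ∑ k, ∑ j, ricUp G k j x * ricDefect G u α β x k j := by
  have hG := hS.toIsMetricOn
  have h2 := natCast_sub_two_ne hn
  have e1 : ∀ i, ∑ j, Bach G i j x * grad G u i x * grad G u j x
      = 1 / ((n : ℝ) - 2) * (∑ k, ∑ j, ricUp G k j x * (grad G u i x * Cotton G k i j x)
        + ∑ k, ∑ j, ricUp G k j x * ∑ l, Weyl G i k l j x * grad G u i x * grad G u l x) := by
    intro i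
    have e2 : ∑ k, ∑ j, ricUp G k j x * (grad G u i x * Cotton G k i j x)
        = grad G u i x * ∑ j, ctr G x (fun k m => cov3 G (Cotton G) m k i j x) * grad G u j x := by
      rw [hS.sum_div_Cotton_mul_grad hn hx hw]
      simp only [Finset.mul_sum]
      exact Finset.sum_congr rfl fun _ _ => Finset.sum_congr rfl fun _ _ => by ring
    have e3 : ∑ k, ∑ j, ricUp G k j x * ∑ l, Weyl G i k l j x * grad G u i x * grad G u l x
        = ∑ l, (∑ k, ∑ j, ricUp G k j x * Weyl G i k l j x) * grad G u i x * grad G u l x := by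
      simp only [Finset.mul_sum, Finset.sum_mul]
      conv_rhs => rw [Finset.sum_comm]
      refine Finset.sum_congr rfl fun k _ => ?_
      rw [Finset.sum_comm]
      exact Finset.sum_congr rfl fun _ _ => Finset.sum_congr rfl fun _ _ => by ring
    rw [e2, e3, Finset.mul_sum, ← Finset.sum_add_distrib, Finset.mul_sum]
    exact Finset.sum_congr rfl fun j _ => by rw [hG.Bach_eq hn hx]; ring
  have e4 : ∀ F : Fin n → Fin n → Fin n → ℝ, ∑ i, ∑ k, ∑ j, ricUp G k j x * F i k j
      = ∑ k, ∑ j, ricUp G k j x * ∑ i, F i k j := by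
    intro F
    rw [Finset.sum_comm]
    refine Finset.sum_congr rfl fun k _ => ?_
    rw [Finset.sum_comm]
    exact Finset.sum_congr rfl fun j _ => by rw [Finset.mul_sum]
  simp only [e1]
  rw [← Finset.mul_sum, Finset.sum_add_distrib, e4 fun i k j => grad G u i x * Cotton G k i j x,
    e4 fun i k j => ∑ l, Weyl G i k l j x * grad G u i x * grad G u l x,
    ← Finset.sum_add_distrib, Finset.mul_sum, Finset.mul_sum]
  refine Finset.sum_congr rfl fun k _ => ?_
  rw [← Finset.sum_add_distrib, Finset.mul_sum, Finset.mul_sum]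
  refine Finset.sum_congr rfl fun j _ => ?_
  rw [← mul_add, hS.sum_Cotton_add_Weyl hn hx hμ hα hβ]
  field_simp

/-- `⟨Ric, T⟩ = |T|²` for `T = Ric - αg - β df ⊗ df`, since `T` is trace-free and
`T(∇f, ∇f) = 0`. -/
lemma sum_ricUp_mul_ricDefect (hn : 3 ≤ n) (hS : IsSolitonOn G u ρ lam U) (hx : x ∈ U)
    {μ α β : ℝ} (hμ : ∀ i, ricGrad G u i x = μ * pd i u x)
    (hα : ((n : ℝ) - 1) * α = Scal G x - μ)
    (hβ : ((n : ℝ) - 1) * (gradSq G u x * β) = n * μ - Scal G x) :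
    ∑ k, ∑ j, ricUp G k j x * ricDefect G u α β x k j
      = ∑ k, ∑ j, raise G x (ricDefect G u α β x) k j * ricDefect G u α β x k j := by
  have hG := hS.toIsMetricOn
  have h1 := natCast_sub_one_ne hn
  have hfw : ctr G x (fun k m => pd k u x * pd m u x) = gradSq G u x := (sum_mul_grad _).symm
  have t1 : ∑ k, ∑ j, gInv G k j x * ricDefect G u α β x k j = 0 := by
    have : ctr G x (fun k j => ricDefect G u α β x k j)
        = Scal G x - α * n - β * gradSq G u x := by
      simp only [ricDefect]
      rw [ctr_sub, ctr_sub, ctr_mul_left, ctr_mul_left α (fun k l => G x k l), hG.ctr_metric hx,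
        hfw, ← Scal_eq_ctr]
    change ctr G x (fun k j => ricDefect G u α β x k j) = 0
    rw [this]
    apply mul_left_cancel₀ h1
    linear_combination (-n : ℝ) * hα - hβ
  have t2 : ∑ k, ∑ j, grad G u k x * grad G u j x * ricDefect G u α β x k j = 0 := by
    have a1 : ∀ k, ∑ j, grad G u k x * grad G u j x * ricDefect G u α β x k j
        = (μ - α - β * gradSq G u x) * (pd k u x * grad G u k x) := by
      intro k
      have : ∀ j, grad G u k x * grad G u j x * ricDefect G u α β x k j
          = grad G u k x * (Ric G k j x * grad G u j x)
            - α * grad G u k x * (G x k j * grad G u j x)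
            - β * pd k u x * grad G u k x * (pd j u x * grad G u j x) := fun j => by
        simp only [ricDefect]; ring
      simp only [this, Finset.sum_sub_distrib, ← Finset.mul_sum, hG.sum_metric_mul_grad hx]
      rw [show ∑ l, Ric G k l x * grad G u l x = μ * pd k u x from hμ k,
        show ∑ l, pd l u x * grad G u l x = gradSq G u x from rfl]
      ring
    have a2 : μ - α - β * gradSq G u x = 0 := by
      apply mul_left_cancel₀ h1
      linear_combination -hα - hβ
    simp only [a1, a2, zero_mul, Finset.sum_const_zero]
  have e : ∀ k j, ricUp G k j x * ricDefect G u α β x k j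
      = raise G x (ricDefect G u α β x) k j * ricDefect G u α β x k j
        + α * (gInv G k j x * ricDefect G u α β x k j)
        + β * (grad G u k x * grad G u j x * ricDefect G u α β x k j) := fun k j => by
    rw [ricUp_eq hG hx (u := u) α β k j]; ring
  simp only [e, Finset.sum_add_distrib, ← Finset.mul_sum, t1, t2]
  ring

/-- Radial nonnegativity of the Bach tensor forces `Ric = αg + β df ⊗ df` wherever `df ≠ 0`. -/
lemma ricDefect_eq_zero (hn : 3 ≤ n) (hS : IsSolitonOn G u ρ lam U) (hx : x ∈ U)
    (hw : ∀ x ∈ U, ∀ i j, pd i (Scal G) x * pd j u x - pd j (Scal G) x * pd i u x = 0) {μ α β : ℝ}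
    (hμ : ∀ i, ricGrad G u i x = μ * pd i u x) (hα : ((n : ℝ) - 1) * α = Scal G x - μ)
    (hβ : ((n : ℝ) - 1) * (gradSq G u x * β) = n * μ - Scal G x) (h0 : gradSq G u x ≠ 0)
    (hB : 0 ≤ ∑ i, ∑ j, Bach G i j x * grad G u i x * grad G u j x) (k l : Fin n) :
    ricDefect G u α β x k l = 0 := by
  have hG := hS.toIsMetricOn
  have hpos : 0 < gradSq G u x / ((n : ℝ) - 2) ^ 2 :=
    div_pos (lt_of_le_of_ne (hG.gradSq_nonneg hx) h0.symm)
      (sq_pos_of_ne_zero (natCast_sub_two_ne hn))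
  rw [hS.sum_Bach_mul_grad hn hx hw hμ hα hβ, hS.sum_ricUp_mul_ricDefect hn hx hμ hα hβ] at hB
  refine eq_zero_of_sum_raise_mul_nonpos hG hx (ricDefect G u α β x) ?_ k l
  by_contra hc
  push Not at hc
  nlinarith [mul_pos hpos hc]

/-! ### Vanishing of the Cotton and Bach tensors -/

lemma ricGrad_eq_mul (hS : IsSolitonOn G u ρ lam U) (hx : x ∈ U)
    (hw : ∀ i j, pd i (Scal G) x * pd j u x - pd j (Scal G) x * pd i u x = 0)
    (h0 : gradSq G u x ≠ 0) (i : Fin n) :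
    ricGrad G u i x = (∑ k, ricGrad G u k x * grad G u k x) / gradSq G u x * pd i u x := by
  rw [div_mul_eq_mul_div, eq_div_iff h0, gradSq, Finset.mul_sum, Finset.sum_mul]
  exact Finset.sum_congr rfl fun k _ => by
    rw [← mul_assoc, hS.ricGrad_wedge hx hw i k]; ring

/-- A trace-free tensor `θ_i g_{jk} - θ_j g_{ik} + Ω_{ij} f_k`, `Ω` antisymmetric, that is
annihilated by `∇f` in the last slot vanishes. -/
lemma eq_zero_of_trace_of_radial (hn : 3 ≤ n) (hG : IsMetricOn G U) (hx : x ∈ U)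
    (h0 : gradSq G u x ≠ 0) (θ : Fin n → ℝ) (Ω : Fin n → Fin n → ℝ) (C : Fin n → Fin n → Fin n → ℝ)
    (hΩ : ∀ i j, Ω i j = - Ω j i)
    (hC : ∀ i j k, C i j k = θ i * G x j k - θ j * G x i k + Ω i j * pd k u x)
    (ht : ∀ i, ctr G x (fun j k => C i j k) = 0)
    (hr : ∀ i j, ∑ k, C i j k * grad G u k x = 0) (i j k : Fin n) : C i j k = 0 := by
  have h1 := natCast_sub_one_ne hn
  have h2 := natCast_sub_two_ne hn
  have a1 : ∀ i, ((n : ℝ) - 1) * θ i + ∑ j, Ω i j * grad G u j x = 0 := by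
    intro i
    have h := ht i
    simp only [hC] at h
    rw [ctr_add, ctr_sub, ctr_mul_left (θ i) (fun j k => G x j k), hG.ctr_metric hx,
      hG.ctr_mul_metric' hx θ i, ← sum_mul_grad] at h
    linarith
  have a2 : ∀ i j, θ i * pd j u x - θ j * pd i u x + Ω i j * gradSq G u x = 0 := by
    intro i j
    have h := hr i j
    have e : ∀ k, C i j k * grad G u k x = θ i * (G x j k * grad G u k x)
        - θ j * (G x i k * grad G u k x) + Ω i j * (pd k u x * grad G u k x) := fun k => by
      rw [hC]; ring
    simp only [e, Finset.sum_add_distrib, Finset.sum_sub_distrib, ← Finset.mul_sum,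
      hG.sum_metric_mul_grad hx] at h
    exact h
  have a3 : ∑ i, θ i * grad G u i x = 0 := by
    have z : ∑ i, ∑ j, Ω i j * grad G u j x * grad G u i x = 0 := by
      have : ∑ i, ∑ j, Ω i j * grad G u j x * grad G u i x
          = - ∑ i, ∑ j, Ω i j * grad G u j x * grad G u i x := by
        conv_lhs => rw [Finset.sum_comm]
        simp only [← Finset.sum_neg_distrib]
        exact Finset.sum_congr rfl fun a _ => Finset.sum_congr rfl fun b _ => by
          rw [hΩ b a]; ring
      linarith
    have : ∑ i, (((n : ℝ) - 1) * θ i + ∑ j, Ω i j * grad G u j x) * grad G u i x = 0 := by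
      simp [a1]
    simp only [add_mul, Finset.sum_add_distrib, Finset.sum_mul, mul_assoc,
      ← Finset.mul_sum] at this
    simp only [mul_assoc] at z
    rw [z, add_zero] at this
    exact (mul_eq_zero.1 this).resolve_left h1
  have a4 : ∀ i, θ i = 0 := by
    intro i
    have e : ∑ j, (θ i * pd j u x - θ j * pd i u x + Ω i j * gradSq G u x) * grad G u j x = 0 := by
      simp [a2]
    have e2 : ∀ j, (θ i * pd j u x - θ j * pd i u x + Ω i j * gradSq G u x) * grad G u j x
        = θ i * (pd j u x * grad G u j x) - pd i u x * (θ j * grad G u j x)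
          + gradSq G u x * (Ω i j * grad G u j x) := fun j => by ring
    simp only [e2, Finset.sum_add_distrib, Finset.sum_sub_distrib, ← Finset.mul_sum, a3] at e
    rw [show ∑ j, pd j u x * grad G u j x = gradSq G u x from rfl] at e
    have e3 : ((n : ℝ) - 2) * gradSq G u x * θ i = 0 := by
      linear_combination gradSq G u x * a1 i - e
    exact (mul_eq_zero.1 e3).resolve_left (mul_ne_zero h2 h0)
  have a5 : Ω i j = 0 := by
    have := a2 i j
    rw [a4 i, a4 j] at this
    simpa [h0] using this
  rw [hC, a4 i, a4 j, a5]; ring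

/-- If `Ric = αg + β df ⊗ df` with smooth `α, β` and `df ≠ 0`, the Cotton tensor vanishes. -/
lemma Cotton_eq_zero (hn : 3 ≤ n) (hS : IsSolitonOn G u ρ lam U) (hx : x ∈ U)
    (hw : ∀ x ∈ U, ∀ i j, pd i (Scal G) x * pd j u x - pd j (Scal G) x * pd i u x = 0)
    (h0 : gradSq G u x ≠ 0) {α β : EuclideanSpace ℝ (Fin n) → ℝ} (hα : ContDiffOn ℝ ∞ α U)
    (hβ : ContDiffOn ℝ ∞ β U) (hT : ∀ y ∈ U, ∀ k l, ricDefect G u (α y) (β y) y k l = 0)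
    (i j k : Fin n) : Cotton G i j k x = 0 := by
  have hG := hS.toIsMetricOn
  have hU := hG.isOpen
  have hp := fun k => contDiffOn_pd hU hS.smooth_potential k
  have hRic : ∀ y ∈ U, ∀ k l, Ric G k l y = α y * G y k l + β y * (pd k u y * pd l u y) :=
    fun y hy k l => by have := hT y hy k l; simp only [ricDefect] at this; linarith
  have hH : ∀ a b, hess G u a b x
      = (ρ * Scal G x + lam - α x) * G x a b - β x * (pd a u x * pd b u x) := fun a b => by
    rw [hS.hess_eq hx, hRic x hx]; ring
  have dG := fun a b => diffAt hU (hG.smooth a b) hx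
  have dp := fun a => diffAt hU (hp a) hx
  have dα := diffAt hU hα hx
  have dβ := diffAt hU hβ hx
  have hcov : ∀ a b c, cov2 G (Ric G) a b c x = pd a α x * G x b c
      + pd a β x * (pd b u x * pd c u x)
      + β x * (hess G u a b x * pd c u x + pd b u x * hess G u a c x) := by
    intro a b c
    have m := hG.cov2_mul_metric hx hα a b c
    have e1 : pd a (Ric G b c) x = pd a (fun y => α y * G y b c) x
        + (pd a β x * (pd b u x * pd c u x)
          + β x * (pd a (pd b u) x * pd c u x + pd b u x * pd a (pd c u) x)) := by
      rw [pd_congr a hU hx fun y hy => hRic y hy b c,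
        pd_add a (dα.fun_mul (dG b c)) (dβ.fun_mul ((dp b).fun_mul (dp c))),
        pd_mul a dβ ((dp b).fun_mul (dp c)), pd_mul a (dp b) (dp c)]
    have e2 : ∀ d e : ℝ, ∀ A F H : Fin n → ℝ, ∑ s, A s * (d * F s + e * H s)
        = ∑ s, A s * (d * F s) + e * ∑ s, A s * H s := by
      intro d e A F H
      rw [Finset.mul_sum, ← Finset.sum_add_distrib]
      exact Finset.sum_congr rfl fun _ _ => by ring
    simp only [cov2, hess, cov1]
    simp only [hRic x hx]
    rw [e1, e2 (α x) (β x) _ (fun s => G x s c) fun s => pd s u x * pd c u x,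
      e2 (α x) (β x) _ (fun s => G x b s) fun s => pd b u x * pd s u x, sum_mul_mul_const,
      sum_mul_const_mul (pd b u x) _ fun s => pd s u x]
    linear_combination m
  set η : ℝ := ρ * Scal G x + lam - α x with hη
  refine eq_zero_of_trace_of_radial hn hG hx h0
    (fun i => pd i α x - β x * η * pd i u x - 1 / (2 * ((n : ℝ) - 1)) * pd i (Scal G) x)
    (fun i j => pd i β x * pd j u x - pd j β x * pd i u x) (fun i j k => Cotton G i j k x)
    (fun i j => by ring) ?_ (fun i => hG.ctr_Cotton hn hx i)
    (fun i j => hS.sum_Cotton_mul_grad hn hx (hw x hx) i j) i j k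
  intro a b c
  simp only [Cotton, hcov, hH, hG.symm hx b a]
  ring

/-- The Bach tensor vanishes at a point near which `C = 0` and at which
`Ric = αg + β df ⊗ df` and `W(∇f, ·, ∇f, ·) = 0`: the contraction of the Weyl tensor with such a
Ricci tensor only involves its trace and its radial part. -/
lemma Bach_eq_zero (hn : 3 ≤ n) (hG : IsMetricOn G U) (hx : x ∈ U)
    (hC : ∀ y ∈ U, ∀ i j k, Cotton G i j k y = 0) {α β : ℝ}
    (hT : ∀ k l, ricDefect G u α β x k l = 0)
    (hW : ∀ i j, ∑ k, ∑ l, Weyl G k i l j x * grad G u k x * grad G u l x = 0) (i j : Fin n) :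
    Bach G i j x = 0 := by
  have hdiv : ∀ m k i j, cov3 G (Cotton G) m k i j x = 0 := by
    intro m k i j
    have := pd_congr m hG.isOpen hx fun y hy => hC y hy k i j
    rw [pd_const] at this
    simp [cov3, this, hC x hx]
  have hup : ∀ a b, ricUp G a b x = α * gInv G a b x + β * (grad G u a x * grad G u b x) := by
    intro a b
    rw [ricUp_eq hG hx (u := u) α β]
    simp [raise, hT]
  have e : ∑ a, ∑ b, ricUp G a b x * Weyl G i a j b x
      = α * ctr G x (fun a b => Weyl G i a j b x)
        + β * ∑ k, ∑ l, Weyl G k i l j x * grad G u k x * grad G u l x := by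
    simp only [ctr, Finset.mul_sum, ← Finset.sum_add_distrib]
    refine Finset.sum_congr rfl fun a _ => Finset.sum_congr rfl fun b _ => ?_
    rw [hup, Weyl_antisymm_left hn a i b j, hG.Weyl_antisymm_right hn hx i a b j]; ring
  rw [hG.Bach_eq hn hx, e, hW, hG.ctr_Weyl hn hx]
  simp [ctr, hdiv]

lemma Bach_eq_zero_of_gradSq_ne_zero (hn : 3 ≤ n) (hS : IsSolitonOn G u ρ lam U)
    (hw : ∀ x ∈ U, ∀ i j, pd i (Scal G) x * pd j u x - pd j (Scal G) x * pd i u x = 0)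
    (hB : ∀ x ∈ U, 0 ≤ ∑ i, ∑ j, Bach G i j x * grad G u i x * grad G u j x)
    (h0 : ∀ y ∈ U, gradSq G u y ≠ 0) (hx : x ∈ U) (i j : Fin n) : Bach G i j x = 0 := by
  have hG := hS.toIsMetricOn
  have h1 := natCast_sub_one_ne hn
  have h2 := natCast_sub_two_ne hn
  -- `μ` is the eigenvalue of the Ricci tensor in the direction of the gradient.
  set μ : EuclideanSpace ℝ (Fin n) → ℝ :=
    fun y => (∑ k, ricGrad G u k y * grad G u k y) / gradSq G u y with hμd
  set α : EuclideanSpace ℝ (Fin n) → ℝ := fun y => (Scal G y - μ y) / ((n : ℝ) - 1) with hαd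
  set β : EuclideanSpace ℝ (Fin n) → ℝ :=
    fun y => (n * μ y - Scal G y) / ((n : ℝ) - 1) / gradSq G u y with hβd
  have sg := hG.contDiffOn_grad hS.smooth_potential
  have sμ : ContDiffOn ℝ ∞ μ U := (ContDiffOn.sum fun k _ =>
    (ContDiffOn.sum fun l _ => (hG.contDiffOn_Ric k l).mul (sg l)).mul (sg k)).div
      hS.contDiffOn_gradSq h0
  have sα : ContDiffOn ℝ ∞ α U := (hG.contDiffOn_Scal.sub sμ).div_const _
  have sβ : ContDiffOn ℝ ∞ β U :=
    (((contDiffOn_const.mul sμ).sub hG.contDiffOn_Scal).div_const _).div hS.contDiffOn_gradSq h0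
  have hμ : ∀ y ∈ U, ∀ i, ricGrad G u i y = μ y * pd i u y := fun y hy i =>
    hS.ricGrad_eq_mul hy (hw y hy) (h0 y hy) i
  have hα : ∀ y ∈ U, ((n : ℝ) - 1) * α y = Scal G y - μ y := fun y _ => by
    simp only [hαd]; field_simp
  have hβ : ∀ y ∈ U, ((n : ℝ) - 1) * (gradSq G u y * β y) = n * μ y - Scal G y := fun y hy => by
    have := h0 y hy
    simp only [hβd]; field_simp
  have hT : ∀ y ∈ U, ∀ k l, ricDefect G u (α y) (β y) y k l = 0 := fun y hy =>
    hS.ricDefect_eq_zero hn hy hw (hμ y hy) (hα y hy) (hβ y hy) (h0 y hy) (hB y hy)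
  have hC : ∀ y ∈ U, ∀ i j k, Cotton G i j k y = 0 := fun y hy =>
    hS.Cotton_eq_zero hn hy hw (h0 y hy) sα sβ hT
  refine Bach_eq_zero hn hG hx hC (hT x hx) (fun a b => ?_) i j
  have := hS.sum_Cotton_add_Weyl hn hx (hμ x hx) (hα x hx) (hβ x hx) a b
  rw [hT x hx] at this
  simpa [hC x hx] using this

lemma Bach_eq_zero_of_pd_eq_zero (hn : 3 ≤ n) (hS : IsSolitonOn G u ρ lam U)
    (h0 : ∀ y ∈ U, ∀ k, pd k u y = 0) (hx : x ∈ U) (i j : Fin n) : Bach G i j x = 0 := by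
  have hG := hS.toIsMetricOn
  have hgr : ∀ y ∈ U, ∀ k, grad G u k y = 0 := fun y hy k => by simp [grad, h0 y hy]
  have hess0 : ∀ a b, hess G u a b x = 0 := by
    intro a b
    have := pd_congr a hG.isOpen hx fun y hy => h0 y hy b
    rw [pd_const] at this
    simp [hess, cov1, this, h0 x hx]
  refine Bach_eq_zero (u := u) (α := ρ * Scal G x + lam) (β := 0) hn hG hx ?_ ?_ ?_ i j
  · intro y hy a b c
    rw [hS.Cotton_eq hn hy]
    simp [ricGrad, hgr y hy]
  · intro k l
    have := hS.hess_eq hx k l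
    rw [hess0] at this
    simp only [ricDefect]; linarith
  · intro a b
    simp [hgr x hx]

/-- The local form of the theorem: the set where `df ≠ 0` together with the interior of the set
where `df = 0` is dense, and the Bach tensor vanishes on both. -/
theorem Bach_eq_zero_of_radially_nonneg (hn : 3 ≤ n) (hS : IsSolitonOn G u ρ lam U)
    (hwedge : ρ = 0 → ∀ x ∈ U, ∀ i j,
      pd i (Scal G) x * pd j u x - pd j (Scal G) x * pd i u x = 0)
    (hB : ∀ x ∈ U, 0 ≤ ∑ i, ∑ j, Bach G i j x * grad G u i x * grad G u j x)
    (hx : x ∈ U) (i j : Fin n) : Bach G i j x = 0 := by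
  have hG := hS.toIsMetricOn
  have hU := hG.isOpen
  have hw : ∀ x ∈ U, ∀ i j, pd i (Scal G) x * pd j u x - pd j (Scal G) x * pd i u x = 0 := by
    by_cases hρ : ρ = 0
    · exact hwedge hρ
    · exact fun x hx i j => hS.pd_Scal_wedge hρ hx i j
  by_contra hne
  have hV : IsOpen (U ∩ Bach G i j ⁻¹' {0}ᶜ) :=
    (hG.continuousOn_Bach i j).isOpen_inter_preimage hU isOpen_compl_singleton
  have hV' : IsOpen (U ∩ gradSq G u ⁻¹' {0}ᶜ) :=
    hS.contDiffOn_gradSq.continuousOn.isOpen_inter_preimage hU isOpen_compl_singleton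
  have hgs : ∀ y ∈ U ∩ Bach G i j ⁻¹' {0}ᶜ, gradSq G u y = 0 := by
    intro y hy
    by_contra hg
    exact hy.2 ((hS.mono hV' Set.inter_subset_left).Bach_eq_zero_of_gradSq_ne_zero hn
      (fun z hz => hw z hz.1) (fun z hz => hB z hz.1) (fun z hz => hz.2) ⟨hy.1, hg⟩ i j)
  exact hne ((hS.mono hV Set.inter_subset_left).Bach_eq_zero_of_pd_eq_zero hn
    (fun y hy => hG.pd_eq_zero_of_gradSq hy.1 (hgs y hy)) ⟨hx, hne⟩ i j)

end IsSolitonOn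

end Coord

/-! ### Components of a Riemannian metric in a chart -/

section Components

variable {n : ℕ} {M : Type*} [TopologicalSpace M] [ChartedSpace (EuclideanSpace ℝ (Fin n)) M]
  [IsManifold (𝓡 n) ∞ M]

lemma contMDiffOn_coordVec {φ : OpenPartialHomeomorph M (EuclideanSpace ℝ (Fin n))}
    (hφ : φ ∈ IsManifold.maximalAtlas (𝓡 n) ∞ M) (i : Fin n) :
    ContMDiffOn (𝓡 n) (𝓡 n).tangent ∞
      (fun x => (⟨φ.symm x, coordVec φ i x⟩ : TangentBundle (𝓡 n) M)) φ.target := by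
  have : IsManifold (𝓡 n) 1 M := IsManifold.of_le (n := ∞) (by norm_cast)
  have hs := contMDiffOn_symm_of_mem_maximalAtlas hφ
  have ht := hs.contMDiffOn_tangentMapWithin (m := ∞) (by simp) φ.open_target.uniqueMDiffOn
  have hc : ContMDiffOn (𝓡 n) (𝓡 n).tangent ∞
      (fun x => (⟨x, (EuclideanSpace.single i (1 : ℝ) : EuclideanSpace ℝ (Fin n))⟩ :
        TangentBundle (𝓡 n) (EuclideanSpace ℝ (Fin n)))) φ.target := fun x _ =>
    contMDiffWithinAt_vectorSpace_iff_contDiffWithinAt.2 contDiffWithinAt_const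
  refine (ht.comp hc fun x hx => hx).congr fun x hx => ?_
  simp only [Function.comp, tangentMapWithin, coordVec]
  rw [mfderivWithin_of_isOpen φ.open_target hx]

lemma contDiffOn_metricIn
    (g : Bundle.ContMDiffRiemannianMetric (𝓡 n) ∞ (EuclideanSpace ℝ (Fin n))
      (fun p : M => TangentSpace (𝓡 n) p))
    {φ : OpenPartialHomeomorph M (EuclideanSpace ℝ (Fin n))}
    (hφ : φ ∈ IsManifold.maximalAtlas (𝓡 n) ∞ M) (i j : Fin n) :
    ContDiffOn ℝ ∞ (fun x => metricIn g φ x i j) φ.target := by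
  rw [← contMDiffOn_iff_contDiffOn]
  have h := ContMDiffOn.clm_bundle_apply₂ (E₃ := Bundle.Trivial M ℝ) (F₃ := ℝ)
    (g.contMDiff.comp_contMDiffOn (contMDiffOn_symm_of_mem_maximalAtlas hφ))
    (contMDiffOn_coordVec hφ i) (contMDiffOn_coordVec hφ j)
  intro x hx
  have hx' := h x hx
  simp only [Bundle.contMDiffWithinAt_totalSpace] at hx'
  exact hx'.2

lemma isMetricOn_metricIn
    (g : Bundle.ContMDiffRiemannianMetric (𝓡 n) ∞ (EuclideanSpace ℝ (Fin n))
      (fun p : M => TangentSpace (𝓡 n) p))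
    {φ : OpenPartialHomeomorph M (EuclideanSpace ℝ (Fin n))}
    (hφ : φ ∈ IsManifold.maximalAtlas (𝓡 n) ∞ M) :
    Coord.IsMetricOn (metricIn g φ) φ.target := by
  refine ⟨φ.open_target, contDiffOn_metricIn g hφ, fun x hx => ?_⟩
  refine Matrix.PosDef.of_dotProduct_mulVec_pos ?_ fun v hv => ?_
  · ext i j
    simp [metricIn, g.symm (φ.symm x) (coordVec φ i x)]
  · have hd : φ.MDifferentiable (𝓡 n) (𝓡 n) :=
      ⟨(contMDiffOn_of_mem_maximalAtlas hφ).mdifferentiableOn (by simp),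
        (contMDiffOn_symm_of_mem_maximalAtlas hφ).mdifferentiableOn (by simp)⟩
    set D : EuclideanSpace ℝ (Fin n) →L[ℝ] TangentSpace (𝓡 n) (φ.symm x) :=
      mfderiv (𝓡 n) (𝓡 n) φ.symm x with hD
    set w : EuclideanSpace ℝ (Fin n) := ∑ i, v i • EuclideanSpace.single i (1 : ℝ) with hw
    have hwi : ∀ i, w i = v i := by
      intro i
      simp [hw, Finset.sum_apply, Pi.single_apply]
    have hw0 : w ≠ 0 := by
      intro h0
      apply hv
      funext i
      rw [← hwi i, h0]; rfl
    have hDw : D w ≠ 0 := by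
      intro h0
      apply hw0
      have h1 := congrArg (fun L => L w) (hd.comp_symm_deriv hx)
      have h2 : (mfderiv (𝓡 n) (𝓡 n) φ (φ.symm x)) (D w) = w := h1
      rw [← h2, h0]
      exact map_zero _
    have hsum : D w = ∑ i, v i • coordVec φ i x := by
      rw [hw, map_sum]
      exact Finset.sum_congr rfl fun i _ => map_smul D _ _
    have hpos := g.pos (φ.symm x) (D w) hDw
    rw [hsum] at hpos
    simp only [map_sum, map_smul, sum_apply, smul_apply,
      smul_eq_mul] at hpos
    simp only [dotProduct, Matrix.mulVec, metricIn, Matrix.of_apply, star_trivial]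
    refine hpos.trans_eq (Finset.sum_congr rfl fun a _ => congrArg (v a * ·) ?_)
    refine Finset.sum_congr rfl fun b _ => ?_
    rw [g.symm (φ.symm x) (coordVec φ a x) (coordVec φ b x), mul_comm]

end Components

end

theorem mainTheorem7 {n : ℕ} (hn : 3 ≤ n) {M : Type*} [TopologicalSpace M]
    [ChartedSpace (EuclideanSpace ℝ (Fin n)) M] [IsManifold (𝓡 n) ∞ M]
    (g : Bundle.ContMDiffRiemannianMetric (𝓡 n) ∞ (EuclideanSpace ℝ (Fin n))
      (fun p : M => TangentSpace (𝓡 n) p))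
    (f : M → ℝ) (ρ lam : ℝ)
    (hsol : IsGradientRhoEinsteinSoliton g f ρ lam)
    (hnontrivial : ¬ ∃ c : ℝ, ∀ p : M, f p = c)
    (hwedge : ρ = 0 → WedgeScalZero g f)
    (hbach : BachRadiallyNonneg g f) :
    BachFlat g := by
  intro φ hφ x hx i j
  have hS : Coord.IsSolitonOn (metricIn g φ) (f ∘ φ.symm) ρ lam φ.target :=
    { isMetricOn_metricIn g hφ with
      smooth_potential := contMDiffOn_iff_contDiffOn.1
        (hsol.smooth.comp_contMDiffOn (contMDiffOn_symm_of_mem_maximalAtlas hφ))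
      equation := hsol.equation φ hφ }
  exact hS.Bach_eq_zero_of_radially_nonneg hn (fun hρ => hwedge hρ φ hφ) (hbach φ hφ) hx i j
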